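/- **Model.** Types $\theta$ have a distribution function $F$ with density $f$ that is continuous and positive on $\Theta=[\underline\theta,\bar\theta]$, $0\le\underline\theta<\bar\theta$; off $\Theta$ put $f=0$, so that $F=0$ below and $F=1$ above $\Theta$. Qualities lie in $Q=[0,q_{\max}]$, the cost $c$ is $C^2$ on $Q$ with $c(0)=c'(0)=0$ and $c',c''>0$ on $(0,q_{\max}]$, and $q_{\max}>0$ satisfies $c(q_{\max})=\bar\theta q_{\max}$. The full-revelation quality $q_f(\theta)$ is given by $c'(q_f(\theta))=\theta$. The principal's utility $\psi$ is $C^2$ on $Q\times\Theta$ with $\psi_{qq}\le 0$, and $\psi_q(q_f(\theta),\theta)\ge 0$ for all $\theta\in\Theta$ (downward bias). Let $\kappa=\inf\{-\psi_{qq}(q,\theta)/c''(q): 0<q\le q_{\max},\ \theta\in\Theta\}$. A deterministic quality scheme is a function $q:\Theta\to Q$ that is increasing and satisfies, for all $\theta\in\Theta$, $\theta q(\theta)-c(q(\theta))=\int_{\underline\theta}^\theta q(x)\,dx+\underline U$ for some constant $\underline U$, and $\theta q(\theta)-c(q(\theta))\ge 0$. It is *optimal* if it maximizes $\int_\Theta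 \psi(q(\theta),\theta)\,dF(\theta)$ among all deterministic quality schemes. **Interval structure.** Let $q$ be a deterministic quality scheme that consists of an exclusion interval and finitely many pooling and fully revealing intervals, in the following sense. There are $k\ge 1$ and $0\le\theta_0<\theta_1<\dots<\theta_k=\bar\theta$ with $\theta_1>\underline\theta$ such that $q=0$ on $[\underline\theta,\theta_0)$ (empty if $\theta_0\le\underline\theta$; a $\theta_0<\underline\theta$ is a hypothetical type), and for each $0\le j<k$ the interval $[\theta_j,\theta_{j+1}]$ is either pooling ($q\equiv q_j$ on $(\theta_j,\theta_{j+1})\cap\Theta$) or fully revealing ($q=q_f$ on $(\theta_j,\theta_{j+1})\cap\Theta$). Put $q_{-1}=0$ and count the exclusion interval as the pooling interval number $-1$ (also when it is empty or a point). At the bottom: if $[\theta_0,\theta_1]$ is pooling, then $\theta_0q_0-c(q_0)=0$ and $c'(q_0)>\underline\theta$ (the latter is automatic when $\theta_0\ge\underline\theta$); if it is fully revealing, then $q_f(\theta_0)=0$, i.e. $\theta_0=0$. At the top: if $[\theta_{k-1},\theta_k]$ is pooling, then $c'(q_{k-1})\ge\bar\theta$ (there is no quality cap). For $0\le j<k$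 and $\theta\ge 0$ let $$r_j(\theta)=\psi_q(q(\theta),\theta)f(\theta)-\kappa\,(\theta-c'(q(\theta)))f(\theta)-\kappa\,(F(\theta)-F(\theta_j)),$$ where the terms with the factor $f(\theta)$ are $0$ off $\Theta$. (In the case $\psi(q,\theta)=\beta(\theta)q-\alpha c(q)+d(\theta)$ of linear delegation, $\kappa=\alpha$ and $r_j(\theta)=(\beta(\theta)-\alpha\theta)f(\theta)-\alpha(F(\theta)-F(\theta_j))$.) **(S-j)**, for adjacent pooling intervals with the qualities $q_{j-1}$ and $q_j$, $0\le j<k$: with $A_j=\frac{1}{c'(q_j)-\theta_j}\int_{\theta_j}^{c'(q_j)}r_j(x)\,dx$, $$\int_{\theta_j}^{\theta}r_j(x)\,dx\ \ge\ A_j\,(\theta-\theta_j)\quad\text{for all }\theta\in[c'(q_{j-1}),c'(q_j)],$$ with equality if $\theta\in\{c'(q_{j-1}),c'(q_j)\}\cap(\underline\theta,\bar\theta)$. **(C-j)**, for a fully revealing interval $[\theta_j,\theta_{j+1}]$: $r_j$ is (weakly) decreasing on $[\theta_j,\theta_{j+1}]$. **Proposition.** If (S-j) holds for every pair of adjacent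 pooling intervals (including the pair of the exclusion interval and a pooling interval $[\theta_0,\theta_1]$) and (C-j) holds on every fully revealing interval, then the quality scheme $q$ is optimal. -/

import Mathlib

open Set MeasureTheory

noncomputable section

/-- The primitives of the rating-design model with their standing assumptions.
Types live in `[lo, hi]`, qualities in `[0, qmax]`; type `θ` gets `θ * w - cost q` from the wage `w`
and the quality `q` (that is, the cost is `cost q / θ`, rescaled by `θ`); the principal gets
`psi q θ`. -/
structure RatingModel where
  /-- lowest and highest type -/
  lo : ℝ
  hi : ℝ
  /-- highest quality -/
  qmax : ℝ
  cost : ℝ → ℝ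
  /-- the principal's utility, as a function of quality and type -/
  psi : ℝ → ℝ → ℝ
  /-- the density of types, extended by zero outside `[lo, hi]` -/
  dens : ℝ → ℝ
  lo_nonneg : 0 ≤ lo
  lo_lt_hi : lo < hi
  dens_cont : ContinuousOn dens (Icc lo hi)
  dens_pos : ∀ θ ∈ Icc lo hi, 0 < dens θ
  dens_zero : ∀ θ, θ ∉ Icc lo hi → dens θ = 0
  dens_total : ∫ θ in lo..hi, dens θ = 1
  /-- `qmax` is the quality at which the highest type is indifferent to the outside option -/
  qmax_pos : 0 < qmax
  qmax_eq : hi * qmax - cost qmax = 0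
  cost_smooth : ContDiffOn ℝ 2 cost (Icc 0 qmax)
  cost_zero : cost 0 = 0
  cost_deriv_zero : derivWithin cost (Icc 0 qmax) 0 = 0
  cost_deriv_pos : ∀ q ∈ Ioc 0 qmax, 0 < derivWithin cost (Icc 0 qmax) q
  cost_deriv2_pos : ∀ q ∈ Ioc 0 qmax,
    0 < derivWithin (derivWithin cost (Icc 0 qmax)) (Icc 0 qmax) q
  psi_smooth : ContDiffOn ℝ 2 (fun p : ℝ × ℝ => psi p.1 p.2) (Icc 0 qmax ×ˢ Icc lo hi)
  psi_concave : ∀ q ∈ Icc 0 qmax, ∀ θ ∈ Icc lo hi,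
    derivWithin (derivWithin (fun x => psi x θ) (Icc 0 qmax)) (Icc 0 qmax) q ≤ 0
  /-- Downward bias: the marginal utility of the principal is nonnegative at the quality
  which the type would choose under full revelation. -/
  downward_bias : ∀ θ ∈ Icc lo hi, ∀ q ∈ Icc 0 qmax, derivWithin cost (Icc 0 qmax) q = θ →
    0 ≤ derivWithin (fun x => psi x θ) (Icc 0 qmax) q

namespace RatingModel

/-- The type space `Θ`. -/
def types (M : RatingModel) : Set ℝ := Icc M.lo M.hi

/-- The set `Q` of qualities. -/
def quals (M : RatingModel) : Set ℝ := Icc 0 M.qmax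

/-- The marginal cost `c'`. -/
def mcost (M : RatingModel) (q : ℝ) : ℝ := derivWithin M.cost M.quals q

/-- The second derivative `c''`. -/
def mcost2 (M : RatingModel) (q : ℝ) : ℝ := derivWithin M.mcost M.quals q

/-- The partial derivative of the principal's utility in the quality. -/
def psiq (M : RatingModel) (q θ : ℝ) : ℝ := derivWithin (fun x => M.psi x θ) M.quals q

/-- The second partial derivative of the principal's utility in the quality. -/
def psiqq (M : RatingModel) (q θ : ℝ) : ℝ := derivWithin (fun x => M.psiq x θ) M.quals q

/-- The distribution function, which is `0` below `lo` and `1` above `hi`. -/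
def cdf (M : RatingModel) (θ : ℝ) : ℝ := ∫ x in Iic θ, M.dens x

/-- The relative concavity `κ = inf (-ψ_qq / c'')`, over the qualities at which `c'' > 0`
is part of the model. -/
def kappa (M : RatingModel) : ℝ :=
  sInf ((fun p : ℝ × ℝ => -M.psiqq p.1 p.2 / M.mcost2 p.1) '' (Ioc 0 M.qmax ×ˢ M.types))

/-- `q` is the quality that type `θ` chooses under full revelation, `q = q_f(θ)`. -/
def IsFullRevelation (M : RatingModel) (q θ : ℝ) : Prop := q ∈ M.quals ∧ M.mcost q = θ

/-- The constraints of the principal's problem over deterministic ratings (there the interim wage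
is the quality itself): monotonicity, the envelope condition, and participation. -/
structure Feasible (M : RatingModel) (q : ℝ → ℝ) : Prop where
  mem : ∀ θ ∈ M.types, q θ ∈ M.quals
  mono : MonotoneOn q M.types
  envelope : ∃ U₀ : ℝ, ∀ θ ∈ M.types, θ * q θ - M.cost (q θ) = (∫ x in M.lo..θ, q x) + U₀
  participation : ∀ θ ∈ M.types, 0 ≤ θ * q θ - M.cost (q θ)

/-- The principal's expected utility. -/
def payoff (M : RatingModel) (q : ℝ → ℝ) : ℝ := ∫ θ in M.lo..M.hi, M.psi (q θ) θ * M.dens θ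

/-- `q` solves the principal's problem over deterministic ratings. -/
def IsOptimal (M : RatingModel) (q : ℝ → ℝ) : Prop :=
  M.Feasible q ∧ ∀ q' : ℝ → ℝ, M.Feasible q' → M.payoff q' ≤ M.payoff q

end RatingModel

/-- A list of intervals `[θ_0, θ_1], …, [θ_{k-1}, θ_k]` above a cutoff `θ_0 = cut 0`; the `j`-th
interval `[cut j, cut (j+1)]`, for `j < k`, is a pooling interval at the quality `level j` if
`pool j` holds, and otherwise a fully revealing interval. Only the values of `cut` up to `k` and of
`pool` and `level` below `k` matter. -/
structure IntervalList where
  k : ℕ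
  cut : ℕ → ℝ
  pool : ℕ → Prop
  level : ℕ → ℝ

namespace IntervalList

/-- The interval preceding the `j`-th one is a pooling interval; the exclusion interval,
which precedes the interval with the number `0`, counts as one. -/
def PrevPool (L : IntervalList) : ℕ → Prop
  | 0 => True
  | j + 1 => L.pool j

/-- The pooling quality `q_{j-1}` on the preceding interval, with `q_{-1} = 0`. -/
def prevLevel (L : IntervalList) : ℕ → ℝ
  | 0 => 0
  | j + 1 => L.level j

end IntervalList

namespace RatingModel

/-- The scheme `q` consists of the exclusion interval `[lo, θ_0)` (empty if `θ_0 ≤ lo`, in which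
case `θ_0` is a hypothetical type) and of the intervals in `L`. -/
structure ConsistsOf (M : RatingModel) (q : ℝ → ℝ) (L : IntervalList) : Prop where
  one_le : 1 ≤ L.k
  cut_nonneg : 0 ≤ L.cut 0
  cut_lt : ∀ j < L.k, L.cut j < L.cut (j + 1)
  lo_lt_cut : M.lo < L.cut 1
  cut_last : L.cut L.k = M.hi
  exclusion : ∀ θ ∈ M.types, θ < L.cut 0 → q θ = 0
  pooling : ∀ j < L.k, L.pool j → ∀ θ ∈ M.types, θ ∈ Ioo (L.cut j) (L.cut (j + 1)) →
    q θ = L.level j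
  revealing : ∀ j < L.k, ¬ L.pool j → ∀ θ ∈ M.types, θ ∈ Ioo (L.cut j) (L.cut (j + 1)) →
    M.IsFullRevelation (q θ) θ
  /-- If the first interval is pooling, then the cutoff type is indifferent between its quality and
  the outside option; the lowest type would not choose that quality or more under full
  revelation, which is automatic unless the cutoff is hypothetical. -/
  bottom_pool : L.pool 0 →
    L.cut 0 * L.level 0 - M.cost (L.level 0) = 0 ∧ M.lo < M.mcost (L.level 0)
  /-- If the first interval is fully revealing, then the quality is continuous at the cutoff,
  `q_f(θ_0) = 0`. -/
  bottom_reveal : ¬ L.pool 0 → M.IsFullRevelation 0 (L.cut 0)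
  /-- There is no cap on the quality: if the last interval is pooling, then its quality is at least
  `q_f(hi)`. -/
  top_pool : L.pool (L.k - 1) → M.hi ≤ M.mcost (L.level (L.k - 1))

/-- The characteristic function
`r_j(θ) = ψ_q(q(θ), θ) f(θ) - κ (θ - c'(q(θ))) f(θ) - κ (F(θ) - F(θ_j))`. -/
def charFun (M : RatingModel) (q : ℝ → ℝ) (L : IntervalList) (j : ℕ) (θ : ℝ) : ℝ :=
  M.psiq (q θ) θ * M.dens θ - M.kappa * (θ - M.mcost (q θ)) * M.dens θ
    - M.kappa * (M.cdf θ - M.cdf (L.cut j))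

/-- The slope `A_j`: the average of `r_j` between `θ_j` and the type `c'(q_j)` that would choose
`q_j` under full revelation. -/
def slope (M : RatingModel) (q : ℝ → ℝ) (L : IntervalList) (j : ℕ) : ℝ :=
  (∫ x in L.cut j..M.mcost (L.level j), M.charFun q L j x) / (M.mcost (L.level j) - L.cut j)

/-- Condition (S-j) at the cut `θ_j` between two adjacent pooling intervals. -/
def ConditionS (M : RatingModel) (q : ℝ → ℝ) (L : IntervalList) (j : ℕ) : Prop :=
  (∀ θ ∈ Icc (M.mcost (L.prevLevel j)) (M.mcost (L.level j)),
    M.slope q L j * (θ - L.cut j) ≤ ∫ x in L.cut j..θ, M.charFun q L j x) ∧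
  ∀ θ ∈ ({M.mcost (L.prevLevel j), M.mcost (L.level j)} : Set ℝ) ∩ Ioo M.lo M.hi,
    ∫ x in L.cut j..θ, M.charFun q L j x = M.slope q L j * (θ - L.cut j)

/-- Condition (C-j) on a fully revealing interval: `r_j` is (weakly) decreasing. -/
def ConditionC (M : RatingModel) (q : ℝ → ℝ) (L : IntervalList) (j : ℕ) : Prop :=
  AntitoneOn (M.charFun q L j) (Icc (L.cut j) (L.cut (j + 1)))

end RatingModel

end

/-! Fix a feasible deviation `q'` and let `gap` be the resulting change in the types' indirect
utility, a primitive of `q' - q` by the envelope condition. By the definition of `kappa`, `ψ + κ c`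
is concave in the quality. Linearising it at `q`, rewriting costs through utilities, and integrating
`gap` by parts against `F - 1` bounds the change in payoff by `gain` at `hi`, which is `κ gap(lo) +
∫ V (q' - q)` with `V = virtual` (`Feasible.payoff_sub_le`). On each interval `V` differs from `r_j`
only by a constant.

It remains to prove `gain(hi) ≤ 0`. The invariant `Controlled` is `gain(x) ≤ V(x) gap(x)` at types
`x` that receive their full-revelation quality; there `gap ≤ 0`, since such a type cannot do better.
It passes through a revealing interval because `V` decreases: `∫ V d(gap)` is at most its boundary
terms (`Controlled.reveal_step`). Across a jump between pooling qualities, the excess `R` in (S-j)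
is a nonnegative primitive of `V - B`. As `q'` is monotone, `∫ (V - B) q'` is at most its boundary
terms, while `∫ (V - B) q` is explicit because `R` vanishes at the cut (`gain_step`). Where `R`
touches zero at an end, its sign compares `B` with `V`, which restores the invariant
(`controlled_pool_step`, `controlled_pool_pool`). At `hi`, downward bias gives `V ≥ 0`; a pooling
quality above `q_f(hi)` is treated through the hypothetical type `c'(q_{k-1}) > hi`. -/

/-! ### Integral inequalities and the gradient inequality. -/

/-- Second mean value inequality: against a nonnegative primitive, a monotone function gains at
most the boundary terms. -/
theorem integral_mul_le_of_monotoneOn {a b : ℝ} (hab : a ≤ b) {ρ g : ℝ → ℝ} {R₀ : ℝ}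
    (hg : MonotoneOn g (Icc a b)) (hρ : IntervalIntegrable ρ volume a b)
    (hR : ∀ x ∈ Icc a b, 0 ≤ R₀ + ∫ t in a..x, ρ t) :
    ∫ x in a..b, ρ x * g x ≤ (R₀ + ∫ t in a..b, ρ t) * g b - R₀ * g a := by
  -- Constant extension beyond `[a, b]` makes `g` monotone on the whole line, hence measurable.
  set G : ℝ → ℝ := fun x => g (projIcc a b hab x) with hG
  have hGm : Monotone G := fun x y hxy =>
    hg (projIcc a b hab x).2 (projIcc a b hab y).2 (monotone_projIcc hab hxy)
  have hGg : ∀ x ∈ Icc a b, G x = g x := fun x hx => by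
    simp only [hG]; rw [projIcc_of_mem hab hx]
  have hGa := hGg a (left_mem_Icc.2 hab)
  have hGb := hGg b (right_mem_Icc.2 hab)
  have hle : G a ≤ G b := hGm hab
  have hmeas : MeasurableSet {p : ℝ × ℝ | p.2 < G p.1} :=
    measurableSet_lt measurable_snd (hGm.measurable.comp measurable_fst)
  -- Layer-cake kernel: the integral in `s` gives `ρ x * (g x - g a)`, the integral in `x` gives `ρ`
  -- over a superlevel set of `g`. Fubini exchanges the two.
  let K : ℝ → ℝ → ℝ := fun x s => if s < G x then ρ x else 0
  have hK : IntegrableOn K.uncurry (uIoc a b ×ˢ uIoc (G a) (G b)) := by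
    have h1 : IntegrableOn (fun p : ℝ × ℝ => ρ p.1) (uIoc a b ×ˢ uIoc (G a) (G b)) := by
      rw [IntegrableOn, Measure.volume_eq_prod, ← Measure.prod_restrict]
      have : IsFiniteMeasure (volume.restrict (uIoc (G a) (G b))) :=
        ⟨by rw [Measure.restrict_apply_univ, uIoc_of_le hle]; simp⟩
      exact (intervalIntegrable_iff.1 hρ).comp_fst _
    have : K.uncurry = {p : ℝ × ℝ | p.2 < G p.1}.indicator (fun p => ρ p.1) := by
      ext p; simp [K, Function.uncurry, indicator]
    rw [this]
    exact h1.indicator hmeas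
  have hswap := intervalIntegral_intervalIntegral_swap hK
  have hin : ∀ x ∈ Icc a b, ∫ s in G a..G b, K x s = ρ x * (g x - g a) := by
    intro x hx
    have hx1 : G a ≤ G x := hGm hx.1
    have hx2 : G x ≤ G b := hGm hx.2
    rw [← intervalIntegral.integral_add_adjacent_intervals (b := G x)]
    · have e1 : ∫ s in G a..G x, K x s = ∫ s in G a..G x, ρ x := by
        rw [intervalIntegral.integral_of_le hx1, intervalIntegral.integral_of_le hx1,
          integral_Ioc_eq_integral_Ioo, integral_Ioc_eq_integral_Ioo]
        exact setIntegral_congr_fun measurableSet_Ioo fun s hs => by simp [K, hs.2]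
      have e2 : ∫ s in G x..G b, K x s = ∫ s in G x..G b, 0 := by
        refine intervalIntegral.integral_congr fun s hs => ?_
        rw [uIcc_of_le hx2] at hs
        simp [K, not_lt.2 hs.1]
      rw [e1, e2]; simp [hGg x hx, hGa]; ring
    all_goals
      have hKx : Measurable (K x) := Measurable.ite measurableSet_Iio measurable_const
        measurable_const
      refine (intervalIntegrable_const (c := |ρ x|)).mono_fun hKx.aestronglyMeasurable ?_
      refine Filter.Eventually.of_forall fun s => ?_
      simp only [K]; split_ifs <;> simp
  have hout : ∀ s ∈ Icc (G a) (G b), ∫ x in a..b, K x s ≤ R₀ + ∫ t in a..b, ρ t := by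
    intro s hs
    by_cases hne : ∃ x ∈ Icc a b, s < G x
    swap
    · push Not at hne
      have : ∫ x in a..b, K x s = ∫ x in a..b, (0 : ℝ) :=
        intervalIntegral.integral_congr fun x hx => by
          rw [uIcc_of_le hab] at hx
          simp [K, not_lt.2 (hne x hx)]
      rw [this]; simpa using hR b (right_mem_Icc.2 hab)
    set T := {x ∈ Icc a b | s < G x} with hT
    have hTne : T.Nonempty := let ⟨x, hx, h⟩ := hne; ⟨x, hx, h⟩
    have hTb : BddBelow T := ⟨a, fun x hx => hx.1.1⟩
    -- Up to its left endpoint the superlevel set is `[c, b]`. Integrating `ρ` over it leaves out `∫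
    -- ρ` on `[a, c]`, which is at least `-R₀` by `hR`.
    set c := sInf T with hc
    have hca : a ≤ c := le_csInf hTne fun x hx => hx.1.1
    have hcb : c ≤ b := let ⟨x, hx⟩ := hTne; (csInf_le hTb hx).trans hx.1.2
    have i1 : IntervalIntegrable ρ volume a c := hρ.mono_set (by
      rw [uIcc_of_le hca, uIcc_of_le hab]; exact Icc_subset_Icc_right hcb)
    have i2 : IntervalIntegrable ρ volume c b := hρ.mono_set (by
      rw [uIcc_of_le hcb, uIcc_of_le hab]; exact Icc_subset_Icc_left hca)
    have k1 : EqOn (fun x => K x s) (fun _ => 0) (Ioo a c) := fun x hx => by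
      have : ¬ s < G x := fun h =>
        absurd (csInf_le hTb (⟨⟨hx.1.le, hx.2.le.trans hcb⟩, h⟩ : x ∈ T)) (not_le.2 hx.2)
      simp [K, this]
    have k2 : EqOn (fun x => K x s) ρ (Ioo c b) := fun x hx => by
      obtain ⟨y, hy, hyx⟩ := exists_lt_of_csInf_lt hTne hx.1
      simp [K, hy.2.trans_le (hGm hyx.le)]
    have j1 : ∫ x in a..c, K x s = 0 := by
      rw [intervalIntegral.integral_of_le hca, integral_Ioc_eq_integral_Ioo,
        setIntegral_congr_fun measurableSet_Ioo k1]; simp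
    have j2 : ∫ x in c..b, K x s = ∫ x in c..b, ρ x := by
      rw [intervalIntegral.integral_of_le hcb, intervalIntegral.integral_of_le hcb,
        integral_Ioc_eq_integral_Ioo, integral_Ioc_eq_integral_Ioo,
        setIntegral_congr_fun measurableSet_Ioo k2]
    have l1 : IntervalIntegrable (fun x => K x s) volume a c := by
      rw [intervalIntegrable_iff_integrableOn_Ioo_of_le hca]
      exact (integrableOn_congr_fun k1 measurableSet_Ioo).2 integrableOn_zero
    have l2 : IntervalIntegrable (fun x => K x s) volume c b := by
      rw [intervalIntegrable_iff_integrableOn_Ioo_of_le hcb] at i2 ⊢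
      exact (integrableOn_congr_fun k2 measurableSet_Ioo).2 i2
    rw [← intervalIntegral.integral_add_adjacent_intervals l1 l2, j1, j2,
      ← intervalIntegral.integral_add_adjacent_intervals i1 i2]
    have := hR c ⟨hca, hcb⟩
    linarith
  have hgi : IntervalIntegrable (fun x => ρ x * g x) volume a b := by
    have h0 : IntervalIntegrable g volume a b :=
      MonotoneOn.intervalIntegrable (by rwa [uIcc_of_le hab])
    refine ((hρ.norm.mul_const (max |g a| |g b|))).mono_fun
      ((intervalIntegrable_iff.1 hρ).aestronglyMeasurable.mul
        (intervalIntegrable_iff.1 h0).aestronglyMeasurable) ?_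
    refine (ae_restrict_iff' measurableSet_uIoc).2 (Filter.Eventually.of_forall fun x hx => ?_)
    rw [uIoc_of_le hab] at hx
    have h1 := hg (left_mem_Icc.2 hab) (Ioc_subset_Icc_self hx) hx.1.le
    have h2 := hg (Ioc_subset_Icc_self hx) (right_mem_Icc.2 hab) hx.2
    have h3 : |g x| ≤ max |g a| |g b| := abs_le_max_abs_abs h1 h2
    simp only [norm_mul, Real.norm_eq_abs, abs_abs]
    exact mul_le_mul_of_nonneg_left (h3.trans (le_abs_self _)) (abs_nonneg _)
  have e1 : ∫ x in a..b, (∫ s in G a..G b, K x s)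
      = (∫ x in a..b, ρ x * g x) - (∫ x in a..b, ρ x) * g a := by
    rw [← intervalIntegral.integral_mul_const, ← intervalIntegral.integral_sub hgi
      (hρ.mul_const _)]
    refine intervalIntegral.integral_congr fun x hx => ?_
    rw [uIcc_of_le hab] at hx
    simp only [hin x hx]; ring
  have e2 : ∫ s in G a..G b, (∫ x in a..b, K x s)
      ≤ ∫ s in G a..G b, (R₀ + ∫ t in a..b, ρ t) := by
    refine intervalIntegral.integral_mono_on hle ?_ intervalIntegrable_const hout
    have h2 := hK
    rw [IntegrableOn, Measure.volume_eq_prod, ← Measure.prod_restrict] at h2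
    have h3 := h2.integral_prod_right
    rw [intervalIntegrable_iff]
    refine h3.congr (Filter.Eventually.of_forall fun s => ?_)
    simp [intervalIntegral.integral_of_le hab, uIoc_of_le hab, Function.uncurry]
  rw [intervalIntegral.integral_const, smul_eq_mul, hGa, hGb] at e2
  rw [e1, hGa, hGb] at hswap
  rw [← hswap] at e2
  linarith [e2]

/-- Integration by parts for two primitives of integrable functions. -/
theorem integral_primitive_mul_add {a b : ℝ} {u v : ℝ → ℝ} {U V : ℝ → ℝ} (hab : a ≤ b)
    (hu : IntervalIntegrable u volume a b) (hv : IntervalIntegrable v volume a b)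
    (hU : ∀ x ∈ Icc a b, U x = U a + ∫ t in a..x, u t)
    (hV : ∀ x ∈ Icc a b, V x = V a + ∫ t in a..x, v t) :
    ∫ x in a..b, (u x * V x + U x * v x) = U b * V b - U a * V a := by
  -- `U` and `V` are only known on `[a, b]`; the primitives themselves are absolutely continuous and
  -- differentiable almost everywhere there.
  set U₁ : ℝ → ℝ := fun x => U a + ∫ t in a..x, u t with hU₁
  set V₁ : ℝ → ℝ := fun x => V a + ∫ t in a..x, v t with hV₁
  have cst : ∀ c : ℝ, AbsolutelyContinuousOnInterval (fun _ : ℝ => c) a b := fun c =>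
    ContDiffOn.absolutelyContinuousOnInterval contDiffOn_const
  have hUa : AbsolutelyContinuousOnInterval U₁ a b :=
    (cst _).add (hu.absolutelyContinuousOnInterval_intervalIntegral left_mem_uIcc)
  have hVa : AbsolutelyContinuousOnInterval V₁ a b :=
    (cst _).add (hv.absolutelyContinuousOnInterval_intervalIntegral left_mem_uIcc)
  have key := hUa.integral_deriv_mul_eq_sub hVa
  rw [hU b (right_mem_Icc.2 hab), hV b (right_mem_Icc.2 hab)]
  have ha : U₁ a = U a ∧ V₁ a = V a := by simp [hU₁, hV₁]
  rw [ha.1, ha.2] at key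
  rw [← key]
  refine intervalIntegral.integral_congr_ae ?_
  filter_upwards [hu.ae_hasDerivAt_integral, hv.ae_hasDerivAt_integral] with x h1 h2 hx
  have hx' : x ∈ uIcc a b := uIoc_subset_uIcc hx
  have d1 : deriv U₁ x = u x := ((h1 hx' a left_mem_uIcc).const_add _).deriv
  have d2 : deriv V₁ x = v x := ((h2 hx' a left_mem_uIcc).const_add _).deriv
  rw [d1, d2, hU x (by rwa [uIcc_of_le hab] at hx'), hV x (by rwa [uIcc_of_le hab] at hx')]

/-- Gradient inequality for a function with antitone derivative. -/
theorem sub_le_mul_of_antitoneOn_deriv {h h' : ℝ → ℝ} {a b : ℝ}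
    (hd : ∀ x ∈ Icc a b, HasDerivWithinAt h (h' x) (Icc a b) x) (ha : AntitoneOn h' (Icc a b))
    {x y : ℝ} (hx : x ∈ Icc a b) (hy : y ∈ Icc a b) : h y - h x ≤ h' x * (y - x) := by
  have mvt : ∀ u ∈ Icc a b, ∀ v ∈ Icc a b, u < v → ∃ c ∈ Ioo u v, h' c * (v - u) = h v - h u := by
    intro u hu v hv huv
    obtain ⟨c, hc, e⟩ := exists_hasDerivAt_eq_slope h h' huv
      (fun z hz => ((hd z ⟨hu.1.trans hz.1, hz.2.trans hv.2⟩).continuousWithinAt.mono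
        (Icc_subset_Icc hu.1 hv.2)))
      (fun z hz => (hd z ⟨hu.1.trans hz.1.le, hz.2.le.trans hv.2⟩).hasDerivAt
        (Icc_mem_nhds (hu.1.trans_lt hz.1) (hz.2.trans_le hv.2)))
    exact ⟨c, hc, by rw [e]; field_simp [sub_ne_zero.2 huv.ne']⟩
  rcases lt_trichotomy x y with hxy | rfl | hxy
  · obtain ⟨c, hc, e⟩ := mvt x hx y hy hxy
    rw [← e]
    exact mul_le_mul_of_nonneg_right (ha hx ⟨hx.1.trans hc.1.le, hc.2.le.trans hy.2⟩ hc.1.le)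
      (sub_nonneg.2 hxy.le)
  · simp
  · obtain ⟨c, hc, e⟩ := mvt y hy x hx hxy
    have := mul_le_mul_of_nonneg_right (ha ⟨hy.1.trans hc.1.le, hc.2.le.trans hx.2⟩ hx hc.2.le)
      (sub_nonneg.2 hxy.le)
    linarith

/-! ### Convexity of the cost, concavity of `ψ + κ c`, and the distribution of types. -/

namespace RatingModel

variable (M : RatingModel)

theorem uniqueDiffOn_quals : UniqueDiffOn ℝ M.quals := uniqueDiffOn_Icc M.qmax_pos

theorem hasDerivWithinAt_cost {x : ℝ} (hx : x ∈ M.quals) :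
    HasDerivWithinAt M.cost (M.mcost x) M.quals x :=
  ((M.cost_smooth.differentiableOn (by norm_num)) x hx).hasDerivWithinAt

theorem contDiffOn_mcost : ContDiffOn ℝ 1 M.mcost M.quals :=
  M.cost_smooth.derivWithin M.uniqueDiffOn_quals (by norm_num)

theorem hasDerivWithinAt_mcost {x : ℝ} (hx : x ∈ M.quals) :
    HasDerivWithinAt M.mcost (M.mcost2 x) M.quals x :=
  ((M.contDiffOn_mcost.differentiableOn (by norm_num)) x hx).hasDerivWithinAt

theorem continuousOn_mcost : ContinuousOn M.mcost M.quals := M.contDiffOn_mcost.continuousOn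

theorem strictMonoOn_mcost : StrictMonoOn M.mcost M.quals := by
  refine strictMonoOn_of_deriv_pos (convex_Icc _ _) M.continuousOn_mcost fun x hx => ?_
  have hx : x ∈ Ioo 0 M.qmax := by rwa [← interior_Icc]
  have hx' : x ∈ Ioc 0 M.qmax := Ioo_subset_Ioc_self hx
  rw [((M.hasDerivWithinAt_mcost (Ioc_subset_Icc_self hx')).hasDerivAt
    (Icc_mem_nhds hx.1 hx.2)).deriv]
  exact M.cost_deriv2_pos x hx'

theorem zero_mem_quals : 0 ∈ M.quals := left_mem_Icc.2 M.qmax_pos.le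

theorem qmax_mem_quals : M.qmax ∈ M.quals := right_mem_Icc.2 M.qmax_pos.le

theorem lo_mem_types : M.lo ∈ M.types := left_mem_Icc.2 M.lo_lt_hi.le

theorem hi_mem_types : M.hi ∈ M.types := right_mem_Icc.2 M.lo_lt_hi.le

theorem mcost_zero : M.mcost 0 = 0 := M.cost_deriv_zero

/-- Strict gradient inequality for the cost. -/
theorem cost_gradient_lt {p x : ℝ} (hp : p ∈ M.quals) (hx : x ∈ M.quals) (hne : x ≠ p) :
    M.cost p + M.mcost p * (x - p) < M.cost x := by
  have hd : ∀ y ∈ Icc 0 M.qmax, HasDerivWithinAt (fun z => -M.cost z) (-M.mcost y)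
      (Icc 0 M.qmax) y := fun y hy => (M.hasDerivWithinAt_cost hy).neg
  have ha : AntitoneOn (fun y => -M.mcost y) (Icc 0 M.qmax) :=
    M.strictMonoOn_mcost.monotoneOn.neg
  -- Two weak gradient inequalities, from `p` to the midpoint and from there to `x`; strictness
  -- comes from the different slopes at `p` and `m`.
  set m := (p + x) / 2 with hm
  have hmQ : m ∈ M.quals := ⟨by linarith [hp.1, hx.1], by linarith [hp.2, hx.2]⟩
  have h1 := sub_le_mul_of_antitoneOn_deriv hd ha hp hmQ
  have h2 := sub_le_mul_of_antitoneOn_deriv hd ha hmQ hx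
  have h3 : 0 < (M.mcost m - M.mcost p) * (x - p) := by
    rcases lt_or_gt_of_ne hne with h | h
    · exact mul_pos_of_neg_of_neg
        (sub_neg.2 (M.strictMonoOn_mcost hmQ hp (by linarith))) (sub_neg.2 h)
    · exact mul_pos (sub_pos.2 (M.strictMonoOn_mcost hp hmQ (by linarith))) (sub_pos.2 h)
  have e1 : m - p = (x - p) / 2 := by rw [hm]; ring
  have e2 : x - m = (x - p) / 2 := by rw [hm]; ring
  rw [e1] at h1
  rw [e2] at h2
  linarith

theorem util_lt {θ p x : ℝ} (hp : p ∈ M.quals) (hx : x ∈ M.quals) (hne : x ≠ p)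
    (h : (θ - M.mcost p) * (x - p) ≤ 0) : θ * x - M.cost x < θ * p - M.cost p := by
  linarith [M.cost_gradient_lt hp hx hne]

theorem util_le_of_mcost_eq {θ p x : ℝ} (hp : p ∈ M.quals) (hx : x ∈ M.quals)
    (h : M.mcost p = θ) : θ * x - M.cost x ≤ θ * p - M.cost p := by
  rcases eq_or_ne x p with rfl | hne
  · exact le_rfl
  · exact (M.util_lt hp hx hne (by rw [h]; simp)).le

/-- Every type has a full-revelation quality. -/
theorem exists_mcost_eq {θ : ℝ} (hθ : θ ∈ M.types) : ∃ p ∈ M.quals, M.mcost p = θ := by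
  -- By strict convexity the marginal cost at `qmax` exceeds the average cost, which is `hi` by the
  -- choice of `qmax`.
  have h1 : M.hi ≤ M.mcost M.qmax := by
    have := M.cost_gradient_lt M.qmax_mem_quals M.zero_mem_quals M.qmax_pos.ne
    rw [M.cost_zero] at this
    have h2 := M.qmax_eq
    by_contra! h
    nlinarith [M.qmax_pos]
  have := intermediate_value_Icc M.qmax_pos.le M.continuousOn_mcost
  refine this ⟨?_, hθ.2.trans h1⟩
  rw [M.mcost_zero]; exact M.lo_nonneg.trans hθ.1

/-- A quality that a type weakly prefers to all others is its full-revelation quality. -/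
theorem mcost_eq_of_forall_util_le {θ p : ℝ} (hθ : θ ∈ M.types) (hp : p ∈ M.quals)
    (h : ∀ x ∈ M.quals, θ * x - M.cost x ≤ θ * p - M.cost p) : M.mcost p = θ := by
  obtain ⟨x, hx, e⟩ := M.exists_mcost_eq hθ
  rcases eq_or_ne p x with rfl | hne
  · exact e
  · exact absurd (M.util_lt (θ := θ) hx hp hne (by rw [e]; simp)) (not_lt.2 (h x hx))

theorem contDiffOn_psi_section {θ : ℝ} (hθ : θ ∈ M.types) :
    ContDiffOn ℝ 2 (fun x => M.psi x θ) M.quals :=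
  M.psi_smooth.comp (f := fun x : ℝ => (x, θ)) (contDiff_id.prodMk contDiff_const).contDiffOn
    fun _ hx => ⟨hx, hθ⟩

theorem hasDerivWithinAt_psi {x θ : ℝ} (hx : x ∈ M.quals) (hθ : θ ∈ M.types) :
    HasDerivWithinAt (fun x => M.psi x θ) (M.psiq x θ) M.quals x :=
  (((M.contDiffOn_psi_section hθ).differentiableOn (by norm_num)) x hx).hasDerivWithinAt

theorem contDiffOn_psiq_section {θ : ℝ} (hθ : θ ∈ M.types) :
    ContDiffOn ℝ 1 (fun x => M.psiq x θ) M.quals :=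
  (M.contDiffOn_psi_section hθ).derivWithin M.uniqueDiffOn_quals (by norm_num)

theorem hasDerivWithinAt_psiq {x θ : ℝ} (hx : x ∈ M.quals) (hθ : θ ∈ M.types) :
    HasDerivWithinAt (fun x => M.psiq x θ) (M.psiqq x θ) M.quals x :=
  (((M.contDiffOn_psiq_section hθ).differentiableOn (by norm_num)) x hx).hasDerivWithinAt

theorem continuousOn_psi :
    ContinuousOn (fun p : ℝ × ℝ => M.psi p.1 p.2) (M.quals ×ˢ M.types) :=
  M.psi_smooth.continuousOn

/-- Joint continuity is needed because both arguments vary along `θ ↦ (q θ, θ)`. The partial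
derivative is the total derivative applied to `(1, 0)`. -/
theorem continuousOn_psiq :
    ContinuousOn (fun p : ℝ × ℝ => M.psiq p.1 p.2) (M.quals ×ˢ M.types) := by
  have hu : UniqueDiffOn ℝ (M.quals ×ˢ M.types) :=
    M.uniqueDiffOn_quals.prod (uniqueDiffOn_Icc M.lo_lt_hi)
  have h1 := (M.psi_smooth.continuousOn_fderivWithin hu (by norm_num)).clm_apply
    (continuousOn_const (c := ((1 : ℝ), (0 : ℝ))))
  refine h1.congr fun p hp => ?_
  have hf := ((M.psi_smooth.differentiableOn (by norm_num)) p hp).hasFDerivWithinAt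
  have hg : HasDerivWithinAt (fun x : ℝ => (x, p.2)) ((1 : ℝ), (0 : ℝ)) M.quals p.1 :=
    ((hasDerivAt_id _).prodMk (hasDerivAt_const _ _)).hasDerivWithinAt
  have hm : MapsTo (fun x : ℝ => (x, p.2)) M.quals (M.quals ×ˢ M.types) :=
    fun x hx => ⟨hx, hp.2⟩
  have := HasFDerivWithinAt.comp_hasDerivWithinAt (x := p.1) hf hg hm
  exact this.derivWithin (M.uniqueDiffOn_quals _ hp.1)

theorem kappa_le {x θ : ℝ} (hx : x ∈ Ioc 0 M.qmax) (hθ : θ ∈ M.types) :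
    M.kappa * M.mcost2 x ≤ -M.psiqq x θ := by
  have hpos : ∀ y ∈ Ioc 0 M.qmax, 0 < M.mcost2 y := M.cost_deriv2_pos
  have h : M.kappa ≤ -M.psiqq x θ / M.mcost2 x := by
    -- Concavity of `ψ` and `c'' > 0` bound the quotients below by `0`, so the infimum is genuine.
    refine csInf_le ⟨0, ?_⟩ ⟨(x, θ), ⟨hx, hθ⟩, rfl⟩
    rintro _ ⟨p, hp, rfl⟩
    exact div_nonneg (neg_nonneg.2 (M.psi_concave p.1 (Ioc_subset_Icc_self hp.1) p.2 hp.2))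
      (hpos _ hp.1).le
  exact (le_div_iff₀ (hpos x hx)).1 h

/-- `ψ + κ c` is concave in the quality. -/
theorem psi_sub_le {x y θ : ℝ} (hx : x ∈ M.quals) (hy : y ∈ M.quals) (hθ : θ ∈ M.types) :
    M.psi y θ - M.psi x θ ≤ (M.psiq x θ + M.kappa * M.mcost x) * (y - x)
      - M.kappa * (M.cost y - M.cost x) := by
  have hd : ∀ z ∈ Icc 0 M.qmax, HasDerivWithinAt (fun z => M.psi z θ + M.kappa * M.cost z)
      (M.psiq z θ + M.kappa * M.mcost z) (Icc 0 M.qmax) z := fun z hz =>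
    (M.hasDerivWithinAt_psi hz hθ).add ((M.hasDerivWithinAt_cost hz).const_mul _)
  have hd' : ∀ z ∈ M.quals, HasDerivWithinAt (fun z => M.psiq z θ + M.kappa * M.mcost z)
      (M.psiqq z θ + M.kappa * M.mcost2 z) M.quals z := fun z hz =>
    (M.hasDerivWithinAt_psiq hz hθ).add ((M.hasDerivWithinAt_mcost hz).const_mul _)
  have ha : AntitoneOn (fun z => M.psiq z θ + M.kappa * M.mcost z) (Icc 0 M.qmax) := by
    refine antitoneOn_of_hasDerivWithinAt_nonpos (convex_Icc _ _)
      (fun z hz => (hd' z hz).continuousWithinAt)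
      (fun z hz => (hd' z (interior_subset hz)).mono interior_subset) fun z hz => ?_
    -- Only interior qualities matter, so a vanishing `c''` at `0` does no harm.
    rw [interior_Icc] at hz
    linarith [M.kappa_le (Ioo_subset_Ioc_self hz) hθ]
  have := sub_le_mul_of_antitoneOn_deriv hd ha hx hy
  linarith

/-- The density vanishes off the type space, so integrability there extends to the line. This covers
the integrals in (S-j) over hypothetical types. -/
theorem integrable_mul_dens {g : ℝ → ℝ}
    (hg : IntervalIntegrable g volume M.lo M.hi) :
    Integrable (fun θ => g θ * M.dens θ) := by
  have h : IntervalIntegrable (fun θ => g θ * M.dens θ) volume M.lo M.hi :=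
    hg.mul_continuousOn (by rw [uIcc_of_le M.lo_lt_hi.le]; exact M.dens_cont)
  rw [intervalIntegrable_iff_integrableOn_Icc_of_le M.lo_lt_hi.le] at h
  refine (integrableOn_iff_integrable_of_support_subset fun θ hθ => ?_).1 h
  by_contra hn
  exact hθ (by simp [M.dens_zero θ hn])

theorem integrable_dens : Integrable M.dens := by
  simpa using M.integrable_mul_dens (g := fun _ => 1) intervalIntegrable_const

theorem cdf_sub (x y : ℝ) : M.cdf y - M.cdf x = ∫ t in x..y, M.dens t :=
  intervalIntegral.integral_Iic_sub_Iic M.integrable_dens.integrableOn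
    M.integrable_dens.integrableOn

theorem cdf_of_le {x : ℝ} (hx : x ≤ M.lo) : M.cdf x = 0 := by
  rw [cdf, integral_Iic_eq_integral_Iio, setIntegral_congr_fun measurableSet_Iio
    (g := fun _ => 0) fun t ht => M.dens_zero t fun h => absurd (h.1.trans_lt ht) (not_lt.2 hx)]
  simp

theorem cdf_of_ge {x : ℝ} (hx : M.hi ≤ x) : M.cdf x = 1 := by
  have h1 := M.cdf_sub M.lo M.hi
  rw [M.dens_total, M.cdf_of_le le_rfl] at h1
  have h2 := M.cdf_sub M.hi x
  rw [intervalIntegral.integral_of_le hx, setIntegral_congr_fun measurableSet_Ioc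
    (g := fun _ => 0) fun t ht => M.dens_zero t fun h => absurd ht.1 (not_lt.2 h.2)] at h2
  simp at h2
  linarith

theorem continuous_cdf : Continuous M.cdf := by
  have : M.cdf = fun x => ∫ t in M.lo..x, M.dens t := by
    ext x; rw [← M.cdf_sub, M.cdf_of_le le_rfl, sub_zero]
  rw [this]
  exact M.integrable_dens.continuous_primitive _

/-! ### Integrability, incentive compatibility and the linearised payoff. -/

variable {M}

/-- A monotone `q` is almost everywhere measurable, and `g` is bounded on the compact rectangle;
cutting `g` off outside it gives a Borel function to compose with. -/
theorem Feasible.intervalIntegrable_comp {q : ℝ → ℝ} (hq : M.Feasible q) {g : ℝ × ℝ → ℝ}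
    (hg : ContinuousOn g (M.quals ×ˢ M.types)) :
    IntervalIntegrable (fun θ => g (q θ, θ)) volume M.lo M.hi := by
  have hK : IsCompact (M.quals ×ˢ M.types) := isCompact_Icc.prod isCompact_Icc
  obtain ⟨C, hC⟩ := hK.exists_bound_of_continuousOn hg
  have hqm : AEMeasurable q (volume.restrict M.types) :=
    aemeasurable_restrict_of_monotoneOn measurableSet_Icc hq.mono
  have hind : Measurable ((M.quals ×ˢ M.types).indicator g) := by
    classical
    rw [← piecewise_eq_indicator]
    exact hg.measurable_piecewise continuousOn_const hK.measurableSet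
  have hm : AEMeasurable (fun θ => (M.quals ×ˢ M.types).indicator g (q θ, θ))
      (volume.restrict M.types) :=
    hind.comp_aemeasurable (hqm.prodMk aemeasurable_id)
  have heq : ∀ᵐ θ ∂(volume.restrict M.types),
      (M.quals ×ˢ M.types).indicator g (q θ, θ) = g (q θ, θ) :=
    (ae_restrict_iff' measurableSet_Icc).2 (Filter.Eventually.of_forall fun θ hθ =>
      indicator_of_mem (mk_mem_prod (hq.mem θ hθ) hθ) _)
  rw [intervalIntegrable_iff_integrableOn_Icc_of_le M.lo_lt_hi.le]
  refine Integrable.of_bound (μ := volume.restrict (Icc M.lo M.hi))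
    (hm.congr heq).aestronglyMeasurable C ?_
  exact (ae_restrict_iff' measurableSet_Icc).2 (Filter.Eventually.of_forall fun θ hθ =>
    hC (q θ, θ) ⟨hq.mem θ hθ, hθ⟩)

theorem Feasible.intervalIntegrable {q : ℝ → ℝ} (hq : M.Feasible q) {a b : ℝ}
    (ha : a ∈ M.types) (hb : b ∈ M.types) : IntervalIntegrable q volume a b :=
  MonotoneOn.intervalIntegrable (hq.mono.mono (ordConnected_Icc.uIcc_subset ha hb))

theorem Feasible.mul_intervalIntegrable {p ρ : ℝ → ℝ} (hp : M.Feasible p) {a b : ℝ}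
    (ha : a ∈ M.types) (hb : b ∈ M.types) (hρ : IntervalIntegrable ρ volume a b) :
    IntervalIntegrable (fun θ => ρ θ * p θ) volume a b := by
  refine (hρ.mul_const M.qmax).mono_fun ((intervalIntegrable_iff.1 hρ).aestronglyMeasurable.mul
    (intervalIntegrable_iff.1 (hp.intervalIntegrable ha hb)).aestronglyMeasurable) ?_
  refine (ae_restrict_iff' measurableSet_uIoc).2 (Filter.Eventually.of_forall fun θ hθ => ?_)
  have h := hp.mem θ ((ordConnected_Icc.uIcc_subset ha hb) (uIoc_subset_uIcc hθ))
  simp only [norm_mul, Real.norm_eq_abs]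
  refine mul_le_mul_of_nonneg_left ?_ (abs_nonneg _)
  rw [abs_of_nonneg h.1]
  exact h.2.trans (le_abs_self _)

variable (M)

/-- The indirect utility of a type under a scheme. -/
noncomputable def surplus (q : ℝ → ℝ) (θ : ℝ) : ℝ := θ * q θ - M.cost (q θ)

/-- The difference of the indirect utilities under two schemes. -/
noncomputable def gap (q q' : ℝ → ℝ) (θ : ℝ) : ℝ := M.surplus q' θ - M.surplus q θ

/-- The characteristic function normalised to be independent of the interval. -/
noncomputable def virtual (q : ℝ → ℝ) (θ : ℝ) : ℝ :=
  (M.psiq (q θ) θ - M.kappa * (θ - M.mcost (q θ))) * M.dens θ + M.kappa * (1 - M.cdf θ)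

theorem charFun_eq (q : ℝ → ℝ) (L : IntervalList) (j : ℕ) (θ : ℝ) :
    M.charFun q L j θ = M.virtual q θ - M.kappa * (1 - M.cdf (L.cut j)) := by
  rw [charFun, virtual]; ring

theorem virtual_of_lt_lo (q : ℝ → ℝ) {θ : ℝ} (hθ : θ < M.lo) : M.virtual q θ = M.kappa := by
  rw [virtual, M.dens_zero θ fun h => absurd hθ (not_lt.2 h.1), M.cdf_of_le hθ.le]; ring

theorem virtual_of_hi_lt (q : ℝ → ℝ) {θ : ℝ} (hθ : M.hi < θ) : M.virtual q θ = 0 := by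
  rw [virtual, M.dens_zero θ fun h => absurd hθ (not_lt.2 h.2), M.cdf_of_ge hθ.le]; ring

variable {M}

theorem Feasible.virtual_intervalIntegrable {q : ℝ → ℝ} (hq : M.Feasible q) (a b : ℝ) :
    IntervalIntegrable (M.virtual q) volume a b := by
  have hc : ContinuousOn (fun p : ℝ × ℝ => M.psiq p.1 p.2 - M.kappa * (p.2 - M.mcost p.1))
      (M.quals ×ˢ M.types) :=
    M.continuousOn_psiq.sub (continuousOn_const.mul (continuousOn_snd.sub
      (M.continuousOn_mcost.comp continuousOn_fst fun p hp => hp.1)))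
  exact (M.integrable_mul_dens (hq.intervalIntegrable_comp hc)).intervalIntegrable.add
    ((continuous_const.mul (continuous_const.sub M.continuous_cdf)).intervalIntegrable _ _)

theorem Feasible.surplus_sub {q : ℝ → ℝ} (hq : M.Feasible q) {x y : ℝ}
    (hx : x ∈ M.types) (hy : y ∈ M.types) :
    M.surplus q y - M.surplus q x = ∫ t in x..y, q t := by
  obtain ⟨U, hU⟩ := hq.envelope
  rw [surplus, surplus, hU x hx, hU y hy, ← intervalIntegral.integral_interval_sub_left
    (hq.intervalIntegrable M.lo_mem_types hy) (hq.intervalIntegrable M.lo_mem_types hx)]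
  ring

theorem Feasible.continuousOn_surplus {q : ℝ → ℝ} (hq : M.Feasible q) :
    ContinuousOn (M.surplus q) M.types := by
  have h := intervalIntegral.continuousOn_primitive_interval'
    (hq.intervalIntegrable M.lo_mem_types M.hi_mem_types) left_mem_uIcc
  rw [uIcc_of_le M.lo_lt_hi.le] at h
  refine (continuousOn_const (c := M.surplus q M.lo) |>.add h).congr fun x hx => ?_
  have := hq.surplus_sub M.lo_mem_types hx
  show M.surplus q x = M.surplus q M.lo + ∫ t in M.lo..x, q t
  linarith

/-- Incentive compatibility. -/
theorem Feasible.util_le_surplus {q : ℝ → ℝ} (hq : M.Feasible q) {x y : ℝ}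
    (hx : x ∈ M.types) (hy : y ∈ M.types) : y * q x - M.cost (q x) ≤ M.surplus q y := by
  have h := hq.surplus_sub hx hy
  have key : (y - x) * q x ≤ ∫ t in x..y, q t := by
    rcases le_total x y with hxy | hxy
    · have := intervalIntegral.integral_mono_on hxy intervalIntegrable_const
        (hq.intervalIntegrable hx hy) (f := fun _ => q x) fun t ht =>
        hq.mono hx ⟨hx.1.trans ht.1, ht.2.trans hy.2⟩ ht.1
      simpa using this
    · have := intervalIntegral.integral_mono_on hxy
        (hq.intervalIntegrable hy hx) intervalIntegrable_const (g := fun _ => q x) fun t ht =>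
        hq.mono ⟨hy.1.trans ht.1, ht.2.trans hx.2⟩ hx ht.2
      rw [intervalIntegral.integral_symm]
      simp at this
      linarith
  rw [← h] at key
  have : M.surplus q x = x * q x - M.cost (q x) := rfl
  linarith

theorem Feasible.gap_eq {q q' : ℝ → ℝ} (hq : M.Feasible q) (hq' : M.Feasible q') {x y : ℝ}
    (hx : x ∈ M.types) (hy : y ∈ M.types) :
    M.gap q q' y = M.gap q q' x + ∫ t in x..y, (q' t - q t) := by
  rw [intervalIntegral.integral_sub (hq'.intervalIntegrable hx hy) (hq.intervalIntegrable hx hy),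
    ← hq.surplus_sub hx hy, ← hq'.surplus_sub hx hy, gap, gap]
  ring

/-- The change in the principal's payoff, linearised at `q`, as an integral against the
characteristic function. -/
theorem Feasible.payoff_sub_le {q q' : ℝ → ℝ} (hq : M.Feasible q) (hq' : M.Feasible q') :
    M.payoff q' - M.payoff q ≤
      M.kappa * M.gap q q' M.lo + ∫ θ in M.lo..M.hi, M.virtual q θ * (q' θ - q θ) := by
  have iΔ : IntervalIntegrable (fun θ => q' θ - q θ) volume M.lo M.hi :=
    (hq'.intervalIntegrable M.lo_mem_types M.hi_mem_types).sub
      (hq.intervalIntegrable M.lo_mem_types M.hi_mem_types)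
  have ipay : ∀ {p : ℝ → ℝ}, M.Feasible p →
      IntervalIntegrable (fun θ => M.psi (p θ) θ * M.dens θ) volume M.lo M.hi := fun hp =>
    (M.integrable_mul_dens
      (hp.intervalIntegrable_comp M.continuousOn_psi)).intervalIntegrable
  have hgc : ContinuousOn (M.gap q q') (uIcc M.lo M.hi) := by
    rw [uIcc_of_le M.lo_lt_hi.le]
    exact hq'.continuousOn_surplus.sub hq.continuousOn_surplus
  have iparts : IntervalIntegrable
      (fun θ => (q' θ - q θ) * (M.cdf θ - 1) + M.gap q q' θ * M.dens θ) volume M.lo M.hi :=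
    (iΔ.mul_continuousOn (M.continuous_cdf.sub continuous_const).continuousOn).add
      (M.integrable_dens.intervalIntegrable.continuousOn_mul hgc)
  -- With `F - 1` in place of `F` the boundary term at `hi` vanishes and only `gap` at `lo`
  -- survives.
  have parts := integral_primitive_mul_add (U := M.gap q q') (V := fun θ => M.cdf θ - 1)
    M.lo_lt_hi.le iΔ (M.integrable_dens.intervalIntegrable (a := M.lo) (b := M.hi))
    (fun x hx => hq.gap_eq hq' M.lo_mem_types hx)
    (fun x _ => by rw [← M.cdf_sub]; ring)
  simp only [M.cdf_of_le le_rfl, M.cdf_of_ge le_rfl] at parts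
  have ivirt : IntervalIntegrable (fun θ => M.virtual q θ * (q' θ - q θ)) volume M.lo M.hi := by
    have hv := hq.virtual_intervalIntegrable M.lo M.hi
    simpa only [mul_sub] using (hq'.mul_intervalIntegrable M.lo_mem_types M.hi_mem_types hv).sub
      (hq.mul_intervalIntegrable M.lo_mem_types M.hi_mem_types hv)
  rw [payoff, payoff, ← intervalIntegral.integral_sub (ipay hq') (ipay hq)]
  have hpt := intervalIntegral.integral_mono_on M.lo_lt_hi.le ((ipay hq').sub (ipay hq))
    (ivirt.add (iparts.const_mul M.kappa)) fun θ hθ => ?_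
  · rw [intervalIntegral.integral_add ivirt (iparts.const_mul _),
      intervalIntegral.integral_const_mul, parts] at hpt
    refine hpt.trans (le_of_eq ?_)
    ring
  -- Concavity of `ψ + κ c`, with the cost difference written as `θ (q' - q) - gap`.
  · have h := mul_le_mul_of_nonneg_right (M.psi_sub_le (hq.mem θ hθ) (hq'.mem θ hθ) hθ)
      (M.dens_pos θ hθ).le
    refine le_trans (le_of_eq (by ring)) (h.trans (le_of_eq ?_))
    simp only [virtual, gap, surplus]
    ring

end RatingModel

/-! ### What feasibility imposes on the intervals and cuts. -/

namespace RatingModel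

variable {M : RatingModel} {q q' : ℝ → ℝ} {L : IntervalList}

theorem Feasible.gap_nonpos (hq : M.Feasible q) (hq' : M.Feasible q') {θ : ℝ}
    (hθ : θ ∈ M.types) (h : M.mcost (q θ) = θ) : M.gap q q' θ ≤ 0 :=
  sub_nonpos.2 (M.util_le_of_mcost_eq (hq.mem θ hθ) (hq'.mem θ hθ) h)

namespace ConsistsOf

theorem cut_lt_cut (hL : M.ConsistsOf q L) {i j : ℕ} (hij : i < j) (hj : j ≤ L.k) :
    L.cut i < L.cut j := by
  induction j with
  | zero => omega
  | succ n ih =>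
    have h := hL.cut_lt n (by omega)
    rcases Nat.lt_succ_iff_lt_or_eq.1 hij with h' | rfl
    · exact (ih h' (by omega)).trans h
    · exact h

theorem cut_lt_hi (hL : M.ConsistsOf q L) {j : ℕ} (hj : j < L.k) : L.cut j < M.hi :=
  hL.cut_last ▸ hL.cut_lt_cut hj le_rfl

theorem cut_succ_le_hi (hL : M.ConsistsOf q L) {j : ℕ} (hj : j < L.k) : L.cut (j + 1) ≤ M.hi := by
  rcases Nat.lt_or_eq_of_le (Nat.succ_le_of_lt hj) with h | h
  · exact (hL.cut_lt_hi h).le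
  · exact (h ▸ hL.cut_last).le

theorem lo_lt_cut_succ (hL : M.ConsistsOf q L) {j : ℕ} (hj : j < L.k) : M.lo < L.cut (j + 1) := by
  rcases Nat.eq_zero_or_pos j with rfl | h
  · exact hL.lo_lt_cut
  · exact hL.lo_lt_cut.trans (hL.cut_lt_cut (by omega) (by omega))

theorem cut_succ_mem (hL : M.ConsistsOf q L) {j : ℕ} (hj : j < L.k) : L.cut (j + 1) ∈ M.types :=
  ⟨(hL.lo_lt_cut_succ hj).le, hL.cut_succ_le_hi hj⟩

theorem max_lt (hL : M.ConsistsOf q L) {j : ℕ} (hj : j < L.k) :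
    max M.lo (L.cut j) < L.cut (j + 1) :=
  _root_.max_lt (hL.lo_lt_cut_succ hj) (hL.cut_lt j hj)

theorem mem_types_of_mem (hL : M.ConsistsOf q L) {j : ℕ} (hj : j < L.k) {θ : ℝ}
    (hθ : θ ∈ Ioo (max M.lo (L.cut j)) (L.cut (j + 1))) : θ ∈ M.types :=
  ⟨((le_max_left _ _).trans_lt hθ.1).le, (hθ.2.le.trans (hL.cut_succ_le_hi hj))⟩

theorem eq_level (hL : M.ConsistsOf q L) {j : ℕ} (hj : j < L.k) (hp : L.pool j) {θ : ℝ}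
    (hθ : θ ∈ Ioo (max M.lo (L.cut j)) (L.cut (j + 1))) : q θ = L.level j :=
  hL.pooling j hj hp θ (hL.mem_types_of_mem hj hθ) ⟨(le_max_right _ _).trans_lt hθ.1, hθ.2⟩

theorem mcost_eq (hL : M.ConsistsOf q L) {j : ℕ} (hj : j < L.k) (hp : ¬ L.pool j) {θ : ℝ}
    (hθ : θ ∈ Ioo (max M.lo (L.cut j)) (L.cut (j + 1))) : M.mcost (q θ) = θ :=
  (hL.revealing j hj hp θ (hL.mem_types_of_mem hj hθ)
    ⟨(le_max_right _ _).trans_lt hθ.1, hθ.2⟩).2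

theorem level_mem (hL : M.ConsistsOf q L) (hq : M.Feasible q) {j : ℕ} (hj : j < L.k)
    (hp : L.pool j) : L.level j ∈ M.quals := by
  obtain ⟨x, hx⟩ := exists_between (hL.max_lt hj)
  rw [← hL.eq_level hj hp hx]
  exact hq.mem x (hL.mem_types_of_mem hj hx)

theorem util_level_le (hL : M.ConsistsOf q L) (hq : M.Feasible q) {j : ℕ} (hj : j < L.k)
    (hp : L.pool j) {θ : ℝ} (hθ : θ ∈ M.types) :
    θ * L.level j - M.cost (L.level j) ≤ M.surplus q θ := by
  obtain ⟨x, hx⟩ := exists_between (hL.max_lt hj)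
  rw [← hL.eq_level hj hp hx]
  exact hq.util_le_surplus (hL.mem_types_of_mem hj hx) hθ

/-- The values of `q` at the cuts are not prescribed, but the surplus is continuous, so the formula
extends to the endpoints. -/
theorem surplus_eq (hL : M.ConsistsOf q L) (hq : M.Feasible q) {j : ℕ} (hj : j < L.k)
    (hp : L.pool j) {θ : ℝ} (hθ : θ ∈ Icc (max M.lo (L.cut j)) (L.cut (j + 1))) :
    M.surplus q θ = θ * L.level j - M.cost (L.level j) := by
  have hsub : Icc (max M.lo (L.cut j)) (L.cut (j + 1)) ⊆ M.types := fun x hx =>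
    ⟨(le_max_left _ _).trans hx.1, hx.2.trans (hL.cut_succ_le_hi hj)⟩
  have h : EqOn (M.surplus q) (fun θ => θ * L.level j - M.cost (L.level j))
      (Ioo (max M.lo (L.cut j)) (L.cut (j + 1))) := fun x hx => by
    simp only [surplus, hL.eq_level hj hp hx]
  exact h.of_subset_closure (hq.continuousOn_surplus.mono hsub) (by fun_prop) Ioo_subset_Icc_self
    (closure_Ioo (hL.max_lt hj).ne).ge hθ

theorem util_le_surplus_of_reveal (hL : M.ConsistsOf q L) (hq : M.Feasible q) {j : ℕ}
    (hj : j < L.k) (hp : ¬ L.pool j) {θ : ℝ}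
    (hθ : θ ∈ Icc (max M.lo (L.cut j)) (L.cut (j + 1))) {x : ℝ} (hx : x ∈ M.quals) :
    θ * x - M.cost x ≤ M.surplus q θ := by
  have hsub : Icc (max M.lo (L.cut j)) (L.cut (j + 1)) ⊆ M.types := fun x hx =>
    ⟨(le_max_left _ _).trans hx.1, hx.2.trans (hL.cut_succ_le_hi hj)⟩
  have hcl := closure_Ioo (hL.max_lt hj).ne
  refine le_on_closure (f := fun θ => θ * x - M.cost x) (g := M.surplus q)
    (s := Ioo (max M.lo (L.cut j)) (L.cut (j + 1))) (fun y hy => ?_) (by fun_prop)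
    (by rw [hcl]; exact hq.continuousOn_surplus.mono hsub) (by rwa [hcl])
  exact M.util_le_of_mcost_eq (hq.mem y (hL.mem_types_of_mem hj hy)) hx (hL.mcost_eq hj hp hy)

theorem mcost_eq_of_mem_Icc (hL : M.ConsistsOf q L) (hq : M.Feasible q) {j : ℕ}
    (hj : j < L.k) (hp : ¬ L.pool j) {θ : ℝ}
    (hθ : θ ∈ Icc (max M.lo (L.cut j)) (L.cut (j + 1))) : M.mcost (q θ) = θ := by
  have hθ' : θ ∈ M.types := ⟨(le_max_left _ _).trans hθ.1, hθ.2.trans (hL.cut_succ_le_hi hj)⟩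
  exact M.mcost_eq_of_forall_util_le hθ' (hq.mem θ hθ')
    fun x hx => hL.util_le_surplus_of_reveal hq hj hp hθ hx

/-- Marginal cost increases along the scheme, so it suffices to look at a type inside the first
interval. -/
theorem lo_lt_mcost_level (hL : M.ConsistsOf q L) (hq : M.Feasible q) {j : ℕ} (hj : j < L.k)
    (hp : L.pool j) : M.lo < M.mcost (L.level j) := by
  have h0 : 0 < L.k := by omega
  obtain ⟨x, hx⟩ := exists_between (hL.max_lt hj)
  obtain ⟨y, hy⟩ := exists_between (hL.max_lt h0)
  rcases Nat.eq_zero_or_pos j with rfl | hj0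
  · exact (hL.bottom_pool hp).2
  have hyx : y ≤ x := by
    have h1 : L.cut 1 ≤ L.cut j := by
      rcases Nat.lt_or_eq_of_le (Nat.succ_le_of_lt hj0) with h | h
      · exact (hL.cut_lt_cut h hj.le).le
      · exact (congrArg L.cut h).le
    exact (hy.2.trans_le (h1.trans ((le_max_right _ _).trans hx.1.le))).le
  have hyt := hL.mem_types_of_mem h0 hy
  have hxt := hL.mem_types_of_mem hj hx
  have hm := M.strictMonoOn_mcost.monotoneOn (hq.mem y hyt) (hq.mem x hxt) (hq.mono hyt hxt hyx)
  rw [hL.eq_level hj hp hx] at hm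
  refine lt_of_lt_of_le ?_ hm
  by_cases hp0 : L.pool 0
  · rw [hL.eq_level h0 hp0 hy]; exact (hL.bottom_pool hp0).2
  · rw [hL.mcost_eq h0 hp0 hy]; exact (le_max_left _ _).trans_lt hy.1

/-- On a pooling interval, and further up to the type that would choose its quality under full
revelation, the quality is constant. -/
theorem eq_level_of_le (hL : M.ConsistsOf q L) (hq : M.Feasible q) {j : ℕ} (hj : j < L.k)
    (hp : L.pool j) {θ : ℝ} (h1 : max M.lo (L.cut j) < θ) (h2 : θ ≤ M.hi)
    (h3 : θ ≤ M.mcost (L.level j)) : q θ = L.level j := by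
  have hθ : θ ∈ M.types := ⟨((le_max_left _ _).trans_lt h1).le, h2⟩
  obtain ⟨x, hx⟩ := exists_between (lt_min h1 (hL.max_lt hj))
  have hx' : x ∈ Ioo (max M.lo (L.cut j)) (L.cut (j + 1)) :=
    ⟨hx.1, hx.2.trans_le (min_le_right _ _)⟩
  have hle := hq.mono (hL.mem_types_of_mem hj hx') hθ (hx.2.trans_le (min_le_left _ _)).le
  rw [hL.eq_level hj hp hx'] at hle
  -- A quality above the level would move further beyond the optimum of `θ`, making it strictly
  -- worse than imitating a pooled type.
  by_contra hne
  exact absurd (M.util_lt (hL.level_mem hq hj hp) (hq.mem θ hθ) hne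
    (mul_nonpos_of_nonpos_of_nonneg (sub_nonpos.2 h3) (sub_nonneg.2 hle)))
    (not_lt.2 (hL.util_level_le hq hj hp hθ))

/-- On a pooling interval, and further down to the type that would choose its quality under full
revelation, the quality is constant. -/
theorem eq_level_of_ge (hL : M.ConsistsOf q L) (hq : M.Feasible q) {j : ℕ} (hj : j < L.k)
    (hp : L.pool j) {θ : ℝ} (h1 : θ < L.cut (j + 1)) (h3 : M.mcost (L.level j) ≤ θ) :
    q θ = L.level j := by
  have hθ : θ ∈ M.types := ⟨(hL.lo_lt_mcost_level hq hj hp).le.trans h3,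
    h1.le.trans (hL.cut_succ_le_hi hj)⟩
  obtain ⟨x, hx⟩ := exists_between (_root_.max_lt h1 (hL.max_lt hj))
  have hx' : x ∈ Ioo (max M.lo (L.cut j)) (L.cut (j + 1)) :=
    ⟨(le_max_right _ _).trans_lt hx.1, hx.2⟩
  have hle := hq.mono hθ (hL.mem_types_of_mem hj hx') ((le_max_left _ _).trans_lt hx.1).le
  rw [hL.eq_level hj hp hx'] at hle
  by_contra hne
  exact absurd (M.util_lt (hL.level_mem hq hj hp) (hq.mem θ hθ) hne
    (mul_nonpos_of_nonneg_of_nonpos (sub_nonneg.2 h3) (sub_nonpos.2 hle)))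
    (not_lt.2 (hL.util_level_le hq hj hp hθ))

theorem level_le_level_succ (hL : M.ConsistsOf q L) (hq : M.Feasible q) {j : ℕ}
    (hj : j + 1 < L.k) (hp : L.pool j) (hp' : L.pool (j + 1)) : L.level j ≤ L.level (j + 1) := by
  have hj' : j < L.k := by omega
  obtain ⟨x, hx⟩ := exists_between (hL.max_lt hj')
  obtain ⟨y, hy⟩ := exists_between (hL.max_lt hj)
  rw [← hL.eq_level hj' hp hx, ← hL.eq_level hj hp' hy]
  exact hq.mono (hL.mem_types_of_mem hj' hx) (hL.mem_types_of_mem hj hy)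
    (hx.2.trans ((le_max_right _ _).trans_lt hy.1)).le

theorem cut_succ_mem_upper (hL : M.ConsistsOf q L) {j : ℕ} (hj : j < L.k) :
    L.cut (j + 1) ∈ Icc (max M.lo (L.cut j)) (L.cut (j + 1)) := ⟨(hL.max_lt hj).le, le_rfl⟩

theorem cut_succ_mem_lower (hL : M.ConsistsOf q L) {j : ℕ} (hj : j + 1 < L.k) :
    L.cut (j + 1) ∈ Icc (max M.lo (L.cut (j + 1))) (L.cut (j + 1 + 1)) := by
  rw [max_eq_right (hL.lo_lt_cut_succ (by omega)).le]
  exact ⟨le_rfl, (hL.cut_lt _ hj).le⟩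

/-- If the quality jumps between adjacent pooling intervals, the cut lies strictly between the
types that would choose the two qualities under full revelation. -/
theorem cut_mem_Ioo (hL : M.ConsistsOf q L) (hq : M.Feasible q) {j : ℕ}
    (hj : j + 1 < L.k) (hp : L.pool j) (hp' : L.pool (j + 1))
    (hlt : L.level j < L.level (j + 1)) :
    L.cut (j + 1) ∈ Ioo (M.mcost (L.level j)) (M.mcost (L.level (j + 1))) := by
  have hj' : j < L.k := by omega
  -- The surplus is continuous, so the cut type is indifferent between the two levels; with the cut
  -- outside the interval one of them would be strictly better.
  have e1 := hL.surplus_eq hq hj' hp (hL.cut_succ_mem_upper hj')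
  have e2 := hL.surplus_eq hq hj hp' (hL.cut_succ_mem_lower hj)
  have m1 := hL.level_mem hq hj' hp
  have m2 := hL.level_mem hq hj hp'
  constructor
  · by_contra! h
    have := M.util_lt m1 m2 hlt.ne'
      (mul_nonpos_of_nonpos_of_nonneg (sub_nonpos.2 h) (sub_nonneg.2 hlt.le))
    linarith
  · by_contra! h
    have := M.util_lt m2 m1 hlt.ne
      (mul_nonpos_of_nonneg_of_nonpos (sub_nonneg.2 h) (sub_nonpos.2 hlt.le))
    linarith

/-- The surplus of the cut type is that of the pooled quality, seen from below, and the best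
attainable one, seen from above. -/
theorem mcost_level_eq_cut_of_pool_reveal (hL : M.ConsistsOf q L) (hq : M.Feasible q) {j : ℕ}
    (hj : j + 1 < L.k) (hp : L.pool j) (hp' : ¬ L.pool (j + 1)) :
    M.mcost (L.level j) = L.cut (j + 1) := by
  have hj' : j < L.k := by omega
  refine M.mcost_eq_of_forall_util_le (hL.cut_succ_mem hj') (hL.level_mem hq hj' hp)
    fun x hx => ?_
  rw [← hL.surplus_eq hq hj' hp (hL.cut_succ_mem_upper hj')]
  exact hL.util_le_surplus_of_reveal hq hj hp' (hL.cut_succ_mem_lower hj) hx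

theorem mcost_level_eq_cut_of_reveal_pool (hL : M.ConsistsOf q L) (hq : M.Feasible q) {j : ℕ}
    (hj : j + 1 < L.k) (hp : ¬ L.pool j) (hp' : L.pool (j + 1)) :
    M.mcost (L.level (j + 1)) = L.cut (j + 1) := by
  have hj' : j < L.k := by omega
  refine M.mcost_eq_of_forall_util_le (hL.cut_succ_mem hj') (hL.level_mem hq hj hp')
    fun x hx => ?_
  rw [← hL.surplus_eq hq hj hp' (hL.cut_succ_mem_lower hj)]
  exact hL.util_le_surplus_of_reveal hq hj' hp (hL.cut_succ_mem_upper hj') hx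

end ConsistsOf

end RatingModel

/-! ### One-sided derivative signs where a primitive touches zero. -/

theorem le_of_forall_integral_left_nonpos {φ : ℝ → ℝ} {a t B : ℝ} (hat : a < t)
    (hφ : ContinuousOn φ (Icc a t)) (h : ∀ x ∈ Ioo a t, ∫ y in x..t, (φ y - B) ≤ 0) :
    φ t ≤ B := by
  by_contra! hlt
  have hev : ∀ᶠ y in nhdsWithin t (Iic t), B < φ y := by
    have hc := (hφ t (right_mem_Icc.2 hat.le)).eventually_const_lt hlt
    rwa [nhdsWithin_Icc_eq_nhdsLE hat] at hc
  obtain ⟨x, hx, hxs⟩ := mem_nhdsLE_iff_exists_Icc_subset.1 hev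
  obtain ⟨x', hx'⟩ := exists_between (max_lt hat hx)
  have hax : a < x' := (le_max_left _ _).trans_lt hx'.1
  have hxx : x ≤ x' := ((le_max_right _ _).trans_lt hx'.1).le
  refine absurd (h x' ⟨hax, hx'.2⟩) (not_le.2 ?_)
  refine intervalIntegral.intervalIntegral_pos_of_pos_on ?_
    (fun y hy => sub_pos.2 (hxs ⟨hxx.trans hy.1.le, hy.2.le⟩)) hx'.2
  refine ContinuousOn.intervalIntegrable ?_
  rw [uIcc_of_le hx'.2.le]
  exact (hφ.mono (Icc_subset_Icc_left hax.le)).sub continuousOn_const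

theorem le_of_forall_integral_right_nonneg {φ : ℝ → ℝ} {t b B : ℝ} (htb : t < b)
    (hφ : ContinuousOn φ (Icc t b)) (h : ∀ x ∈ Ioo t b, 0 ≤ ∫ y in t..x, (φ y - B)) :
    B ≤ φ t := by
  by_contra! hlt
  have hev : ∀ᶠ y in nhdsWithin t (Ici t), φ y < B := by
    have hc := (hφ t (left_mem_Icc.2 htb.le)).eventually_lt_const hlt
    rwa [nhdsWithin_Icc_eq_nhdsGE htb] at hc
  obtain ⟨x, hx, hxs⟩ := mem_nhdsGE_iff_exists_Icc_subset.1 hev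
  obtain ⟨x', hx'⟩ := exists_between (lt_min htb hx)
  have hxb : x' < b := hx'.2.trans_le (min_le_left _ _)
  have hxx : x' ≤ x := (hx'.2.trans_le (min_le_right _ _)).le
  have hint : IntervalIntegrable (fun y => B - φ y) volume t x' := by
    refine ContinuousOn.intervalIntegrable ?_
    rw [uIcc_of_le hx'.1.le]
    exact continuousOn_const.sub (hφ.mono (Icc_subset_Icc_right hxb.le))
  have hpos := intervalIntegral.intervalIntegral_pos_of_pos_on hint
    (fun y hy => sub_pos.2 (hxs ⟨hy.1.le, hy.2.le.trans hxx⟩)) hx'.1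
  have hn := h x' ⟨hx'.1, hxb⟩
  have e : ∫ y in t..x', (φ y - B) = -∫ y in t..x', (B - φ y) := by
    rw [← intervalIntegral.integral_neg]; congr 1; ext y; ring
  linarith

theorem intervalIntegral_congr_Ioo {f g : ℝ → ℝ} {a b : ℝ} (hab : a ≤ b)
    (h : EqOn f g (Ioo a b)) : ∫ x in a..b, f x = ∫ x in a..b, g x := by
  rw [intervalIntegral.integral_of_le hab, intervalIntegral.integral_of_le hab,
    integral_Ioc_eq_integral_Ioo, integral_Ioc_eq_integral_Ioo,
    setIntegral_congr_fun measurableSet_Ioo h]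

/-! ### Propagation of the bound from the lowest to the highest type. -/

namespace RatingModel

variable (M : RatingModel)

/-- The characteristic function with the quality held fixed. -/
noncomputable def virtualAt (p θ : ℝ) : ℝ :=
  (M.psiq p θ - M.kappa * (θ - M.mcost p)) * M.dens θ + M.kappa * (1 - M.cdf θ)

theorem continuousOn_virtualAt {p : ℝ} (hp : p ∈ M.quals) :
    ContinuousOn (M.virtualAt p) M.types := by
  have h : ContinuousOn (fun θ => M.psiq p θ) M.types :=
    M.continuousOn_psiq.comp (f := fun θ : ℝ => (p, θ)) (by fun_prop) fun θ hθ => ⟨hp, hθ⟩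
  exact ((h.sub (by fun_prop)).mul M.dens_cont).add
    (continuous_const.mul (continuous_const.sub M.continuous_cdf)).continuousOn

/-- The upper bound for the gain from a deviation, accumulated over the types up to `x`. -/
noncomputable def gain (q q' : ℝ → ℝ) (x : ℝ) : ℝ :=
  M.kappa * M.gap q q' M.lo + ∫ θ in M.lo..x, M.virtual q θ * (q' θ - q θ)

/-- The deviation to `q'` is controlled at the type `x`, whose quality under `q` is that of full
revelation; if `x` lies above all types, then it is unprofitable. -/
noncomputable def Controlled (q q' : ℝ → ℝ) (x : ℝ) : Prop :=
  (x ≤ M.hi ∧ M.mcost (q x) = x ∧ M.gain q q' x ≤ M.virtual q x * M.gap q q' x) ∨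
    (M.hi < x ∧ M.gain q q' M.hi ≤ 0)

variable {M} {q q' : ℝ → ℝ} {L : IntervalList}

theorem Feasible.virtual_mul_sub_intervalIntegrable (hq : M.Feasible q) (hq' : M.Feasible q')
    {a b : ℝ} (ha : a ∈ M.types) (hb : b ∈ M.types) :
    IntervalIntegrable (fun θ => M.virtual q θ * (q' θ - q θ)) volume a b := by
  have hv := hq.virtual_intervalIntegrable a b
  simpa only [mul_sub] using (hq'.mul_intervalIntegrable ha hb hv).sub
    (hq.mul_intervalIntegrable ha hb hv)

theorem Feasible.gain_sub (hq : M.Feasible q) (hq' : M.Feasible q')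
    {a b : ℝ} (ha : a ∈ M.types) (hb : b ∈ M.types) :
    M.gain q q' b - M.gain q q' a = ∫ θ in a..b, M.virtual q θ * (q' θ - q θ) := by
  rw [← intervalIntegral.integral_interval_sub_left
    (hq.virtual_mul_sub_intervalIntegrable hq' M.lo_mem_types hb)
    (hq.virtual_mul_sub_intervalIntegrable hq' M.lo_mem_types ha), gain, gain]
  ring

theorem gain_lo : M.gain q q' M.lo = M.kappa * M.gap q q' M.lo := by simp [gain]

/-- Control passes through a fully revealing interval. -/
theorem Controlled.reveal_step (hL : M.ConsistsOf q L) (hq : M.Feasible q) (hq' : M.Feasible q')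
    {j : ℕ} (hj : j < L.k) (hp : ¬ L.pool j) (hC : M.ConditionC q L j) {a : ℝ}
    (ha : a ∈ Icc (max M.lo (L.cut j)) (L.cut (j + 1))) (h : M.Controlled q q' a) :
    M.Controlled q q' (L.cut (j + 1)) := by
  set b := L.cut (j + 1) with hb
  have hbt : b ∈ M.types := hL.cut_succ_mem hj
  have hat : a ∈ M.types := ⟨(le_max_left _ _).trans ha.1, ha.2.trans hbt.2⟩
  obtain ⟨-, -, hga⟩ | ⟨h1, -⟩ := h
  swap
  · exact absurd hat.2 (not_le.2 h1)
  refine Or.inl ⟨hbt.2, hL.mcost_eq_of_mem_Icc hq hj hp (hL.cut_succ_mem_upper hj), ?_⟩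
  have hmono : MonotoneOn (fun θ => -M.virtual q θ) (Icc a b) := fun x hx y hy hxy => by
    have := hC ⟨(le_max_right _ _).trans (ha.1.trans hx.1), hx.2⟩
      ⟨(le_max_right _ _).trans (ha.1.trans hy.1), hy.2⟩ hxy
    rw [M.charFun_eq, M.charFun_eq] at this
    simp only
    linarith
  have hi : IntervalIntegrable (fun θ => q' θ - q θ) volume a b :=
    (hq'.intervalIntegrable hat hbt).sub (hq.intervalIntegrable hat hbt)
  have hprim : ∀ x ∈ Icc a b, -M.gap q q' a + ∫ t in a..x, -(q' t - q t) = -M.gap q q' x :=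
    fun x hx => by
      rw [intervalIntegral.integral_neg, hq.gap_eq hq' hat
        (⟨hat.1.trans hx.1, hx.2.trans hbt.2⟩ : x ∈ M.types)]
      ring
  -- `-gap` is nonnegative on a revealing interval and `-V` increases, so the second mean value
  -- inequality replaces an integration by parts that would differentiate `V`.
  have key := integral_mul_le_of_monotoneOn ha.2 (R₀ := -M.gap q q' a) hmono hi.neg fun x hx => by
    have := hprim x hx
    simp only [Pi.neg_apply] at this ⊢
    rw [this]
    exact neg_nonneg.2 (hq.gap_nonpos hq' ⟨hat.1.trans hx.1, hx.2.trans hbt.2⟩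
      (hL.mcost_eq_of_mem_Icc hq hj hp ⟨ha.1.trans hx.1, hx.2⟩))
  have hpb := hprim b (right_mem_Icc.2 ha.2)
  simp only [Pi.neg_apply] at key
  rw [hpb] at key
  have e : ∫ θ in a..b, -(q' θ - q θ) * -M.virtual q θ = M.gain q q' b - M.gain q q' a := by
    rw [hq.gain_sub hq' hat hbt]; congr 1; ext θ; ring
  rw [e] at key
  linarith

/-- Accumulation of the gain across a cut between two pooling qualities `p` and `p'`, where `R` is
a nonnegative primitive of the characteristic function less the slope `B`. -/
theorem gain_step (hq : M.Feasible q) (hq' : M.Feasible q') {a c b p p' B : ℝ} {R : ℝ → ℝ}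
    (ha : a ∈ M.types) (hb : b ∈ M.types) (hac : a ≤ c) (hcb : c ≤ b)
    (hR : ∀ x ∈ Icc a b, ∀ y ∈ Icc a b, R y - R x = ∫ θ in x..y, (M.virtual q θ - B))
    (hR0 : ∀ x ∈ Icc a b, 0 ≤ R x) (hc : R c * (p - p') = 0)
    (h1 : ∀ θ ∈ Ioo a c, q θ = p) (h2 : ∀ θ ∈ Ioo c b, q θ = p')
    (hs : M.gain q q' a - B * M.gap q q' a ≤ R a * (q' a - p)) :
    M.gain q q' b - B * M.gap q q' b ≤ R b * (q' b - p') := by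
  have hab := hac.trans hcb
  have hsub : Icc a b ⊆ M.types := Icc_subset_Icc ha.1 hb.2
  have ham := left_mem_Icc.2 hab
  have hbm := right_mem_Icc.2 hab
  have hcm : c ∈ Icc a b := ⟨hac, hcb⟩
  have hct := hsub hcm
  have hρ : ∀ x y, IntervalIntegrable (fun θ => M.virtual q θ - B) volume x y := fun x y =>
    (hq.virtual_intervalIntegrable x y).sub intervalIntegrable_const
  have hRa : ∀ x ∈ Icc a b, R a + ∫ θ in a..x, (M.virtual q θ - B) = R x := fun x hx => by
    rw [← hR a ham x hx]; ring
  have key := integral_mul_le_of_monotoneOn hab (R₀ := R a) (hq'.mono.mono hsub) (hρ a b)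
    fun x hx => by rw [hRa x hx]; exact hR0 x hx
  rw [hRa b hbm] at key
  -- Here `q` is a step function and the integral is exact; the remaining term at `c` is removed by
  -- `hc`.
  have eq : ∫ θ in a..b, (M.virtual q θ - B) * q θ = p * (R c - R a) + p' * (R b - R c) := by
    rw [← intervalIntegral.integral_add_adjacent_intervals
      (hq.mul_intervalIntegrable ha hct (hρ a c)) (hq.mul_intervalIntegrable hct hb (hρ c b)),
      hR a ham c hcm, hR c hcm b hbm, ← intervalIntegral.integral_const_mul,
      ← intervalIntegral.integral_const_mul,
      intervalIntegral_congr_Ioo hac (g := fun θ => p * (M.virtual q θ - B))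
        fun θ hθ => by simp only [h1 θ hθ]; ring,
      intervalIntegral_congr_Ioo hcb (g := fun θ => p' * (M.virtual q θ - B))
        fun θ hθ => by simp only [h2 θ hθ]; ring]
  have eg : M.gain q q' b - M.gain q q' a = (∫ θ in a..b, (M.virtual q θ - B) * q' θ)
      - (∫ θ in a..b, (M.virtual q θ - B) * q θ) + B * (M.gap q q' b - M.gap q q' a) := by
    have i1 := hq'.mul_intervalIntegrable ha hb (hρ a b)
    have i2 := hq.mul_intervalIntegrable ha hb (hρ a b)
    have i3 := ((hq'.intervalIntegrable ha hb).sub (hq.intervalIntegrable ha hb)).const_mul B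
    rw [hq.gain_sub hq' ha hb, hq.gap_eq hq' ha hb, add_sub_cancel_left,
      ← intervalIntegral.integral_const_mul, ← intervalIntegral.integral_sub i1 i2,
      ← intervalIntegral.integral_add (i1.sub i2) i3]
    congr 1; ext θ; ring
  rw [eq] at eg
  linarith

/-- The excess of the integral of the characteristic function over the line in (S-j). -/
noncomputable def excess (M : RatingModel) (q : ℝ → ℝ) (L : IntervalList) (j : ℕ) (θ : ℝ) : ℝ :=
  (∫ x in L.cut j..θ, M.charFun q L j x) - M.slope q L j * (θ - L.cut j)

/-- The slope in (S-j), in terms of the normalised characteristic function. -/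
noncomputable def slope' (M : RatingModel) (q : ℝ → ℝ) (L : IntervalList) (j : ℕ) : ℝ :=
  M.slope q L j + M.kappa * (1 - M.cdf (L.cut j))

theorem Feasible.excess_sub (hq : M.Feasible q) (j : ℕ) (x y : ℝ) :
    M.excess q L j y - M.excess q L j x = ∫ θ in x..y, (M.virtual q θ - M.slope' q L j) := by
  have hi : ∀ x y, IntervalIntegrable (M.charFun q L j) volume x y := fun x y => by
    rw [show M.charFun q L j = _ from funext (M.charFun_eq q L j)]
    exact (hq.virtual_intervalIntegrable x y).sub intervalIntegrable_const
  have e : ∫ θ in x..y, (M.virtual q θ - M.slope' q L j)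
      = ∫ θ in x..y, (M.charFun q L j θ - M.slope q L j) := by
    congr 1; ext θ; rw [M.charFun_eq, slope']; ring
  rw [e, intervalIntegral.integral_sub (hi x y) intervalIntegrable_const,
    ← intervalIntegral.integral_interval_sub_left (hi (L.cut j) y) (hi (L.cut j) x),
    intervalIntegral.integral_const, excess, excess, smul_eq_mul]
  ring

theorem excess_cut (j : ℕ) : M.excess q L j (L.cut j) = 0 := by simp [excess]

theorem excess_mcost_level {j : ℕ} (h : L.cut j < M.mcost (L.level j)) :
    M.excess q L j (M.mcost (L.level j)) = 0 := by
  rw [excess, slope, div_mul_cancel₀ _ (sub_ne_zero.2 h.ne'), sub_self]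

/-- Control passes from the type `a` to the type that would choose the next pooling quality under
full revelation. -/
theorem controlled_pool_step (hL : M.ConsistsOf q L) (hq : M.Feasible q) (hq' : M.Feasible q')
    {j : ℕ} (hj : j < L.k) (hp : L.pool j) {a c p : ℝ} (ha : a ∈ M.types) (hac : a ≤ c)
    (hct : L.cut j < M.mcost (L.level j)) (hcc : c = max a (L.cut j))
    (hat : a < M.mcost (L.level j))
    (hR0 : ∀ x ∈ Icc a (M.mcost (L.level j)), 0 ≤ M.excess q L j x)
    (hc : M.excess q L j c * (p - L.level j) = 0)
    (h1 : ∀ θ ∈ Ioo a c, q θ = p)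
    (hs : M.gain q q' a - M.slope' q L j * M.gap q q' a ≤ M.excess q L j a * (q' a - p)) :
    M.Controlled q q' (M.mcost (L.level j)) := by
  set t := M.mcost (L.level j) with ht
  set B := M.slope' q L j with hB
  have hlt : M.lo < t := hL.lo_lt_mcost_level hq hj hp
  have hchi : c ≤ M.hi := hcc ▸ max_le ha.2 (hL.cut_lt_hi hj).le
  have hctt : c ≤ t := hcc ▸ max_le hat.le hct.le
  have hRt : M.excess q L j t = 0 := excess_mcost_level hct
  have hq2 : ∀ θ, max M.lo (L.cut j) < θ → θ ≤ M.hi → θ ≤ t → q θ = L.level j :=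
    fun θ h1 h2 h3 => hL.eq_level_of_le hq hj hp h1 h2 h3
  have hmc : max M.lo (L.cut j) ≤ c := hcc ▸ max_le_max ha.1 le_rfl
  have step : ∀ b, c ≤ b → b ≤ t → b ≤ M.hi →
      M.gain q q' b - B * M.gap q q' b ≤ M.excess q L j b * (q' b - L.level j) :=
    fun b hcb hbt hbh => gain_step hq hq' ha ⟨ha.1.trans (hac.trans hcb), hbh⟩ hac hcb
      (fun x _ y _ => hq.excess_sub j x y) (fun x hx => hR0 x ⟨hx.1, hx.2.trans hbt⟩) hc h1
      (fun θ hθ => hq2 θ (hmc.trans_lt hθ.1) (hθ.2.le.trans hbh) (hθ.2.le.trans hbt)) hs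
  rcases le_or_gt t M.hi with hth | hth
  · have hqt : q t = L.level j := hq2 t (max_lt hlt hct) hth le_rfl
    refine Or.inl ⟨hth, by rw [hqt], ?_⟩
    have hS := step t hctt le_rfl hth
    rw [hRt, zero_mul] at hS
    have hgap : M.gap q q' t ≤ 0 := hq.gap_nonpos hq' ⟨hlt.le, hth⟩ (by rw [hqt])
    have hv : ∀ θ, max M.lo (L.cut j) < θ → θ ≤ t → M.virtual q θ = M.virtualAt (L.level j) θ :=
      fun θ h1 h2 => by rw [virtual, virtualAt, hq2 θ h1 (h2.trans hth) h2]
    have hmt : max a (max M.lo (L.cut j)) < t := max_lt hat (max_lt hlt hct)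
    -- The excess is nonnegative to the left of `t` and zero at `t`, so its left slope `V(t) - B` is
    -- at most zero. As `gap ≤ 0`, this turns `B gap` into the larger `V(t) gap`.
    have hle : M.virtualAt (L.level j) t ≤ B := by
      refine le_of_forall_integral_left_nonpos hmt ((M.continuousOn_virtualAt
        (hL.level_mem hq hj hp)).mono (Icc_subset_Icc (ha.1.trans (le_max_left _ _)) hth))
        fun x hx => ?_
      have hx1 : max M.lo (L.cut j) < x := (le_max_right _ _).trans_lt hx.1
      rw [intervalIntegral_congr_Ioo hx.2.le (g := fun θ => M.virtual q θ - B)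
        fun θ hθ => by simp only [hv θ (hx1.trans hθ.1) hθ.2.le], ← hq.excess_sub j, hRt]
      have := hR0 x ⟨((le_max_left _ _).trans_lt hx.1).le, hx.2.le⟩
      linarith
    rw [hv t (max_lt hlt hct) le_rfl]
    linarith [mul_le_mul_of_nonpos_right hle hgap]
  · refine Or.inr ⟨hth, ?_⟩
    have hS := step M.hi hchi hth.le le_rfl
    have hcut := hL.cut_lt_hi hj
    have hqh : q M.hi = L.level j := hq2 M.hi (max_lt M.lo_lt_hi hcut) le_rfl hth.le
    -- Above `hi` the function `V` is zero, so the excess falls linearly with slope `-B` to zero at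
    -- `t`; hence also `B ≥ 0`.
    have hR : M.excess q L j M.hi = B * (t - M.hi) := by
      have := hq.excess_sub (L := L) j M.hi t
      rw [intervalIntegral_congr_Ioo hth.le (g := fun _ => -B)
        fun θ hθ => by simp only [M.virtual_of_hi_lt q hθ.1]; ring, hRt] at this
      simp at this
      linarith
    have hB0 : 0 ≤ B := by
      have := hR0 M.hi ⟨ha.2, hth.le⟩
      rw [hR] at this
      exact nonneg_of_mul_nonneg_left this (sub_pos.2 hth)
    have hmax := M.util_le_of_mcost_eq (θ := t) (hL.level_mem hq hj hp)
      (hq'.mem M.hi M.hi_mem_types) rfl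
    -- The left side is the utility of the hypothetical type `t` from `q' hi` less that from the
    -- pooled quality, its optimum.
    have hbr : M.gap q q' M.hi + (t - M.hi) * (q' M.hi - L.level j) ≤ 0 := by
      rw [gap, surplus, surplus, hqh]; linarith
    rw [hR] at hS
    have := mul_nonpos_of_nonneg_of_nonpos hB0 hbr
    linarith

theorem ConditionS.excess_nonneg {j : ℕ} (hS : M.ConditionS q L j) {x : ℝ}
    (hx : x ∈ Icc (M.mcost (L.prevLevel j)) (M.mcost (L.level j))) : 0 ≤ M.excess q L j x :=
  sub_nonneg.2 (hS.1 x hx)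

theorem controlled_pool_pool (hL : M.ConsistsOf q L) (hq : M.Feasible q) (hq' : M.Feasible q')
    {j : ℕ} (hj : j + 1 < L.k) (hp : L.pool j) (hp' : L.pool (j + 1))
    (hS : M.ConditionS q L (j + 1)) (h : M.Controlled q q' (M.mcost (L.level j))) :
    M.Controlled q q' (M.mcost (L.level (j + 1))) := by
  have hj' : j < L.k := by omega
  -- With equal levels there is no jump, and the two statements coincide.
  rcases (hL.level_le_level_succ hq hj hp hp').eq_or_lt with he | hlt
  · rwa [← he]
  have hcut := hL.cut_mem_Ioo hq hj hp hp' hlt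
  set a := M.mcost (L.level j) with ha
  have hlo : M.lo < a := hL.lo_lt_mcost_level hq hj' hp
  have hhi : a < M.hi := hcut.1.trans (hL.cut_lt_hi hj)
  have hat : a ∈ M.types := ⟨hlo.le, hhi.le⟩
  have hR0 : ∀ x ∈ Icc a (M.mcost (L.level (j + 1))), 0 ≤ M.excess q L (j + 1) x :=
    fun x hx => hS.excess_nonneg hx
  have hRa : M.excess q L (j + 1) a = 0 :=
    sub_eq_zero.2 (hS.2 a ⟨Or.inl rfl, hlo, hhi⟩)
  obtain ⟨-, hqa, hga⟩ | ⟨h1, -⟩ := h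
  swap
  · exact absurd hhi (not_lt.2 h1.le)
  have hqc : ∀ θ, a ≤ θ → θ < L.cut (j + 1) → q θ = L.level j :=
    fun θ h1 h2 => hL.eq_level_of_ge hq hj' hp h2 h1
  have hv : ∀ θ, a ≤ θ → θ < L.cut (j + 1) → M.virtual q θ = M.virtualAt (L.level j) θ :=
    fun θ h1 h2 => by rw [virtual, virtualAt, hqc θ h1 h2]
  -- The excess starts at zero and stays nonnegative to the right of `a`. Since `gap ≤ 0` at `a`,
  -- the control with slope `V(a)` implies that with `B`.
  have hB : M.slope' q L (j + 1) ≤ M.virtual q a := by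
    rw [hv a le_rfl hcut.1]
    refine le_of_forall_integral_right_nonneg hcut.1 ((M.continuousOn_virtualAt
      (hL.level_mem hq hj' hp)).mono (Icc_subset_Icc hat.1 (hL.cut_lt_hi hj).le)) fun x hx => ?_
    rw [intervalIntegral_congr_Ioo hx.1.le (g := fun θ => M.virtual q θ - M.slope' q L (j + 1))
      fun θ hθ => by simp only [hv θ hθ.1.le (hθ.2.trans hx.2)], ← hq.excess_sub, hRa, sub_zero]
    exact hR0 x ⟨hx.1.le, (hx.2.trans hcut.2).le⟩
  refine controlled_pool_step hL hq hq' hj hp' (c := L.cut (j + 1)) (p := L.level j) hat hcut.1.le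
    hcut.2 (max_eq_right hcut.1.le).symm (hcut.1.trans hcut.2) hR0
    (by rw [excess_cut, zero_mul]) (fun θ hθ => hqc θ hθ.1.le hθ.2) ?_
  rw [hRa, zero_mul]
  linarith [mul_le_mul_of_nonpos_right hB (hq.gap_nonpos hq' hat hqa)]

theorem cost_nonneg {x : ℝ} (hx : x ∈ M.quals) : 0 ≤ M.cost x := by
  have := M.util_le_of_mcost_eq (θ := 0) M.zero_mem_quals hx M.mcost_zero
  rw [M.cost_zero] at this
  linarith

theorem Feasible.surplus_lo_le (hq : M.Feasible q) : M.surplus q M.lo ≤ M.lo * q M.lo :=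
  sub_le_self _ (cost_nonneg (hq.mem _ M.lo_mem_types))

/-- If `lo = 0`, participation and the cost force zero surplus at `lo` under every feasible scheme.
If `lo > 0`, then `V = κ` at the hypothetical cutoff `0`, and (C-0) gives `V(lo) ≤ κ`. -/
theorem controlled_reveal_bottom (hL : M.ConsistsOf q L) (hq : M.Feasible q)
    (hq' : M.Feasible q') (hp : ¬ L.pool 0) (hC : M.ConditionC q L 0) :
    M.Controlled q q' (L.cut 1) := by
  have hj : 0 < L.k := hL.one_le
  have hcut : L.cut 0 = 0 := by rw [← (hL.bottom_reveal hp).2, M.mcost_zero]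
  have hcl : L.cut 0 ≤ M.lo := hcut ▸ M.lo_nonneg
  have ha : M.lo ∈ Icc (max M.lo (L.cut 0)) (L.cut (0 + 1)) :=
    ⟨max_le le_rfl hcl, hL.lo_lt_cut.le⟩
  have hm := hL.mcost_eq_of_mem_Icc hq hj hp ha
  refine Controlled.reveal_step hL hq hq' hj hp hC ha (Or.inl ⟨M.lo_lt_hi.le, hm, ?_⟩)
  rw [gain_lo]
  rcases M.lo_nonneg.eq_or_lt with h0 | h0
  · have hz : ∀ {p : ℝ → ℝ}, M.Feasible p → M.surplus p M.lo = 0 := fun hp =>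
      le_antisymm (hp.surplus_lo_le.trans_eq (by rw [← h0, zero_mul]))
        (hp.participation _ M.lo_mem_types)
    rw [gap, hz hq, hz hq']; simp
  · have := hC ⟨le_rfl, (hL.cut_lt 0 hj).le⟩ ⟨hcl, hL.lo_lt_cut.le⟩ hcl
    rw [M.charFun_eq, M.charFun_eq, M.virtual_of_lt_lo q (hcut.trans_lt h0)] at this
    exact mul_le_mul_of_nonpos_right (by linarith) (hq.gap_nonpos hq' M.lo_mem_types hm)

theorem controlled_pool_bottom (hL : M.ConsistsOf q L) (hq : M.Feasible q)
    (hq' : M.Feasible q') (hp : L.pool 0) (hS : M.ConditionS q L 0) :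
    M.Controlled q q' (M.mcost (L.level 0)) := by
  have hj : 0 < L.k := hL.one_le
  obtain ⟨hb, hlt⟩ := hL.bottom_pool hp
  have hlev := hL.level_mem hq hj hp
  have hlo := M.lo_nonneg
  have hne : 0 ≠ L.level 0 := fun h => by
    rw [← h, M.mcost_zero] at hlt; exact absurd hlt (not_lt.2 hlo)
  have hpos : 0 < L.level 0 := lt_of_le_of_ne hlev.1 hne
  have hct : L.cut 0 < M.mcost (L.level 0) := by
    have := M.cost_gradient_lt hlev M.zero_mem_quals hne
    rw [M.cost_zero] at this
    by_contra! h
    nlinarith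
  -- Since `c'(q_{-1}) = c'(0) = 0`, (S-0) reaches down to the hypothetical type `0`. Below `lo` the
  -- excess is linear with slope `κ - B`.
  have hR0 : ∀ x ∈ Icc 0 (M.mcost (L.level 0)), 0 ≤ M.excess q L 0 x := fun x hx =>
    hS.excess_nonneg ⟨by rw [IntervalList.prevLevel, M.mcost_zero]; exact hx.1, hx.2⟩
  set B := M.slope' q L 0 with hB
  have hsub : ∀ x y, x ≤ y → y ≤ M.lo →
      M.excess q L 0 y - M.excess q L 0 x = (M.kappa - B) * (y - x) := fun x y hxy hy => by
    rw [hq.excess_sub, intervalIntegral_congr_Ioo hxy (g := fun _ => M.kappa - B)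
      fun θ hθ => by simp only [M.virtual_of_lt_lo q (hθ.2.trans_le hy)]; rfl]
    simp; ring
  have e0 := hsub 0 M.lo hlo le_rfl
  have hRz := hR0 0 ⟨le_rfl, hlo.trans hlt.le⟩
  have hRlo := hR0 M.lo ⟨hlo, hlt.le⟩
  have hv : 0 ≤ M.surplus q' M.lo := hq'.participation _ M.lo_mem_types
  have hv' := hq'.surplus_lo_le
  have hq'0 : 0 ≤ q' M.lo := (hq'.mem _ M.lo_mem_types).1
  have hR0' : ∀ x ∈ Icc M.lo (M.mcost (L.level 0)), 0 ≤ M.excess q L 0 x := fun x hx =>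
    hR0 x ⟨hlo.trans hx.1, hx.2⟩
  rcases le_or_gt M.lo (L.cut 0) with hcl | hcl
  · have hV : M.surplus q M.lo = 0 := by
      rcases hcl.eq_or_lt with h | h
      · rw [hL.surplus_eq hq hj hp ⟨max_le le_rfl h.ge, hL.lo_lt_cut.le⟩, h, hb]
      · rw [surplus, hL.exclusion _ M.lo_mem_types h, M.cost_zero]; simp
    refine controlled_pool_step hL hq hq' hj hp (c := L.cut 0) (p := 0) M.lo_mem_types hcl hct
      (max_eq_right hcl).symm hlt hR0' (by rw [excess_cut, zero_mul])
      (fun θ hθ => hL.exclusion θ ⟨hθ.1.le, (hθ.2.trans (hL.cut_lt_hi hj)).le⟩ hθ.2) ?_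
    rw [gain_lo, gap, hV, sub_zero, sub_zero]
    -- For `B ≤ κ`, the surplus is at most `lo * q' lo` and the excess at `lo` is at least `(κ - B)
    -- lo`. For `B ≥ κ`, the left side is nonpositive and the right side nonnegative.
    rcases le_total B M.kappa with h | h
    · have h1 := mul_le_mul_of_nonneg_left hv' (sub_nonneg.2 h)
      have h2 := mul_nonneg hRz hq'0
      have e : M.excess q L 0 M.lo = M.excess q L 0 0 + (M.kappa - B) * M.lo := by linarith
      rw [e]
      linarith
    · have h1 := mul_nonneg hRlo hq'0
      have h2 := mul_le_mul_of_nonneg_right h hv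
      linarith
  · have hV := hL.surplus_eq hq hj hp (θ := M.lo) ⟨max_le le_rfl hcl.le, hL.lo_lt_cut.le⟩
    have e1 := hsub (L.cut 0) M.lo hcl.le le_rfl
    rw [excess_cut, sub_zero] at e1
    have hκ : 0 ≤ M.kappa - B := by
      rw [e1] at hRlo
      exact nonneg_of_mul_nonneg_left hRlo (sub_pos.2 hcl)
    refine controlled_pool_step hL hq hq' hj hp (c := M.lo) (p := L.level 0) M.lo_mem_types le_rfl
      hct (max_eq_left hcl.le).symm hlt hR0' (by rw [sub_self, mul_zero])
      (fun θ hθ => absurd (hθ.1.trans hθ.2) (lt_irrefl _)) ?_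
    -- The excess at `0` equals `-(κ - B) θ_0` and is nonnegative, while `κ ≥ B`: a hypothetical
    -- cutoff is either `0` or has slope `B = κ`.
    have hz : (M.kappa - B) * L.cut 0 = 0 := by
      refine le_antisymm ?_ (mul_nonneg hκ hL.cut_nonneg)
      linarith
    rw [gain_lo, gap, hV, e1]
    have h1 := mul_le_mul_of_nonneg_left hv' hκ
    have e2 : (M.kappa - B) * (M.lo - L.cut 0) * (q' M.lo - L.level 0)
        = (M.kappa - B) * (M.lo * q' M.lo) - (M.kappa - B) * L.cut 0 * q' M.lo
          - (M.kappa - B) * (M.lo * L.level 0 - L.cut 0 * L.level 0) := by ring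
    rw [e2, hz, zero_mul, sub_zero]
    have e3 : M.cost (L.level 0) = L.cut 0 * L.level 0 := by linarith
    rw [e3]
    linarith

/-- Every interval passes on the control over the deviation. -/
theorem controlled (hL : M.ConsistsOf q L) (hq : M.Feasible q) (hq' : M.Feasible q')
    (hS : ∀ j < L.k, L.PrevPool j → L.pool j → M.ConditionS q L j)
    (hC : ∀ j < L.k, ¬ L.pool j → M.ConditionC q L j) (j : ℕ) (hj : j < L.k) :
    (L.pool j → M.Controlled q q' (M.mcost (L.level j))) ∧
      (¬ L.pool j → M.Controlled q q' (L.cut (j + 1))) := by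
  induction j with
  | zero =>
    exact ⟨fun hp => controlled_pool_bottom hL hq hq' hp (hS 0 hj trivial hp),
      fun hp => controlled_reveal_bottom hL hq hq' hp (hC 0 hj hp)⟩
  | succ j ih =>
    obtain ⟨ih1, ih2⟩ := ih (by omega)
    by_cases hp : L.pool j
    · refine ⟨fun hp' => controlled_pool_pool hL hq hq' hj hp hp' (hS _ hj hp hp') (ih1 hp),
        fun hp' => ?_⟩
      refine (hL.mcost_level_eq_cut_of_pool_reveal hq hj hp hp' ▸ ih1 hp).reveal_step hL hq hq' hj
        hp' (hC _ hj hp') (hL.cut_succ_mem_lower hj)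
    · refine ⟨fun hp' => ?_, fun hp' => (ih2 hp).reveal_step hL hq hq' hj hp' (hC _ hj hp')
        (hL.cut_succ_mem_lower hj)⟩
      rw [hL.mcost_level_eq_cut_of_reveal_pool hq hj hp hp']
      exact ih2 hp

/-- At `hi` the function `V` reduces to `ψ_q f` at the full-revelation quality; this is where
downward bias enters. -/
theorem Controlled.gain_nonpos (hq : M.Feasible q) (hq' : M.Feasible q') {x : ℝ}
    (hx : M.hi ≤ x) (h : M.Controlled q q' x) : M.gain q q' M.hi ≤ 0 := by
  obtain ⟨h1, h2, h3⟩ | ⟨-, h1⟩ := h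
  swap
  · exact h1
  obtain rfl := le_antisymm hx h1
  refine h3.trans (mul_nonpos_of_nonneg_of_nonpos ?_ (hq.gap_nonpos hq' M.hi_mem_types h2))
  rw [virtual, h2, M.cdf_of_ge le_rfl, sub_self, sub_self, mul_zero, sub_zero, add_zero]
  exact mul_nonneg (M.downward_bias M.hi M.hi_mem_types _ (hq.mem _ M.hi_mem_types) h2)
    (M.dens_pos _ M.hi_mem_types).le

end RatingModel

theorem mainTheorem4 (M : RatingModel) (q : ℝ → ℝ) (L : IntervalList)
    (hq : M.Feasible q) (hL : M.ConsistsOf q L)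
    (hS : ∀ j < L.k, L.PrevPool j → L.pool j → M.ConditionS q L j)
    (hC : ∀ j < L.k, ¬ L.pool j → M.ConditionC q L j) :
    M.IsOptimal q := by
  refine ⟨hq, fun q' hq' => ?_⟩
  obtain ⟨n, hn⟩ : ∃ n, L.k = n + 1 := ⟨L.k - 1, by have := hL.one_le; omega⟩
  obtain ⟨h1, h2⟩ := RatingModel.controlled hL hq hq' hS hC n (by omega)
  have hg : M.gain q q' M.hi ≤ 0 := by
    by_cases hp : L.pool n
    · refine (h1 hp).gain_nonpos hq hq' ?_
      have := hL.top_pool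
      rw [hn, Nat.add_sub_cancel] at this
      exact this hp
    · refine (h2 hp).gain_nonpos hq hq' ?_
      rw [← hn, hL.cut_last]
  have := hq.payoff_sub_le hq'
  rw [RatingModel.gain] at hg
  linarith
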